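/- **Conventions.** Let $(X,\mathfrak M,\mu)$ be a $\sigma$-finite measure space and $L^2(X,\mu)$ the complex Hilbert space of square-integrable functions. A *positive kernel operator* on $L^2(X,\mu)$ is a bounded operator $A$ for which there is a $\mu\times\mu$-measurable kernel $a\ge 0$ (a.e.) such that for every $f\in L^2(X,\mu)$ and almost every $x$ the integral $\int_X a(x,y)f(y)\,d\mu(y)$ converges absolutely and equals $(Af)(x)$. For $\alpha>0$ and positive kernel operators $A_1,\dots,A_m$ with kernels $a_1,\dots,a_m$, $A_1^{(\alpha)}\circ\cdots\circ A_m^{(\alpha)}$ denotes the operator with kernel $\prod_{j}a_j(x,y)^{\alpha}$, when this defines an operator on $L^2(X,\mu)$. For sets of positive kernel operators put $\Psi^*=\{A^*:A\in\Psi\}$, $\Psi\Phi=\{AB:A\in\Psi,B\in\Phi\}$, $\Psi^n=\{A_1\cdots A_n:A_i\in\Psi\}$, $$\Psi_1^{(\alpha)}\circ\cdots\circ\Psi_m^{(\alpha)}=\{A_1^{(\alpha)}\circ\cdots\circ A_m^{(\alpha)}:A_j\in\Psi_j\},\qquad \|\Psi\|=\sup_{A\in\Psi}\|A\|,$$ and,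 with $\rho(A)$ the spectral radius of $A$, $$\rho(\Psi)=\limsup_{n\to\infty}\Big[\sup_{A\in\Psi^n}\rho(A)\Big]^{1/n},\qquad \hat\rho(\Psi)=\lim_{n\to\infty}\Big[\sup_{A\in\Psi^n}\|A\|\Big]^{1/n}$$ (suprema of nonnegative quantities over the empty set being $0$). **Theorem.** Let $m\ge 2$ be even and $\tau,\nu\in S_m$. Given bounded sets $\Psi_1,\dots,\Psi_m$ of positive kernel operators on $L^2(X,\mu)$, put $$\Sigma_j=\Psi_{\tau(2j-1)}^*\Psi_{\tau(2j)},\qquad \Sigma_{\frac m2+j}=\Psi_{\tau(2j)}^*\Psi_{\tau(2j-1)}=\Sigma_j^*\qquad (j=1,\dots,\tfrac m2),$$ $$\Omega_i=\Sigma_{\nu(i)}\cdots\Sigma_{\nu(m)}\Sigma_{\nu(1)}\cdots\Sigma_{\nu(i-1)}\qquad (i=1,\dots,m),$$ and let $r\in\{\rho,\hat\rho\}$. (i) All $\Sigma_j$ and $\Omega_i$ are bounded sets of positive kernel operators, the sets $\Psi_1^{(1/m)}\circ\cdots\circ\Psi_m^{(1/m)}$, $\Sigma_1^{(1/m)}\circ\cdots\circ\Sigma_m^{(1/m)}$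 and $\Omega_1^{(1/m)}\circ\cdots\circ\Omega_m^{(1/m)}$ are well-defined bounded sets of positive kernel operators on $L^2(X,\mu)$, and $$\|\Psi_1^{(\frac1m)}\circ\cdots\circ\Psi_m^{(\frac1m)}\|\le r\big(\Sigma_1^{(\frac1m)}\circ\cdots\circ\Sigma_m^{(\frac1m)}\big)^{\frac12}\le r\big(\Omega_1^{(\frac1m)}\circ\cdots\circ\Omega_m^{(\frac1m)}\big)^{\frac1{2m}}\le r\big(\Sigma_{\nu(1)}\cdots\Sigma_{\nu(m)}\big)^{\frac1{2m}}.$$ (ii) Let $R$ be a countable (finite or infinite) index set and let $\Psi_1,\dots,\Psi_m$ be bounded sets of nonnegative matrices that define operators on $\ell^2(R)$, i.e. bounded sets of positive kernel operators on $L^2$ of the counting measure on $R$. If $\alpha\ge\frac1m$, then $\Psi_1^{(\alpha)}\circ\cdots\circ\Psi_m^{(\alpha)}$, $\Sigma_1^{(\alpha)}\circ\cdots\circ\Sigma_m^{(\alpha)}$ and $\Omega_1^{(\alpha)}\circ\cdots\circ\Omega_m^{(\alpha)}$ are well-defined bounded sets of nonnegative matrices that define operators on $\ell^2(R)$, and $$\|\Psi_1^{(\alpha)}\circ\cdots\circ\Psi_m^{(\alpha)}\|\le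 r\big(\Sigma_1^{(\alpha)}\circ\cdots\circ\Sigma_m^{(\alpha)}\big)^{\frac12}\le r\big(\Omega_1^{(\alpha)}\circ\cdots\circ\Omega_m^{(\alpha)}\big)^{\frac1{2m}}\le r\big(\Sigma_{\nu(1)}\cdots\Sigma_{\nu(m)}\big)^{\frac{\alpha}{2}}.$$ -/

import Mathlib

open MeasureTheory Filter
open scoped ENNReal Pointwise

namespace KernelOperators

section SpectralRadii

variable {B : Type*} [NormedRing B] [NormedAlgebra ℂ B]

/-- The norm of a set of operators: the supremum of the norms of its elements. -/
noncomputable def setNorm (S : Set B) : ℝ≥0∞ := ⨆ A ∈ S, ‖A‖ₑ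

/-- The generalized spectral radius `limsup_n (sup_{A ∈ S^n} ρ(A))^{1/n}`. Here `S ^ n` is the
pointwise power, i.e. the set of all products of length `n` of elements of `S`. -/
noncomputable def generalizedSpectralRadius (S : Set B) : ℝ≥0∞ :=
  limsup (fun n : ℕ => (⨆ A ∈ S ^ n, spectralRadius ℂ A) ^ (1 / (n : ℝ))) atTop

/-- The joint spectral radius `lim_n (sup_{A ∈ S^n} ‖A‖)^{1/n}`. For a bounded set the limit
exists (the suprema are submultiplicative in `n`), hence equals the upper limit. -/
noncomputable def jointSpectralRadius (S : Set B) : ℝ≥0∞ :=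
  limsup (fun n : ℕ => setNorm (S ^ n) ^ (1 / (n : ℝ))) atTop

end SpectralRadii

section Kernels

variable {X : Type*} [MeasurableSpace X]

/-- Bounded linear operators on the complex Hilbert space `L²(X, μ)`. -/
abbrev L2Op (μ : Measure X) := Lp ℂ 2 μ →L[ℂ] Lp ℂ 2 μ

variable {μ : Measure X}

/-- `a` is a nonnegative kernel of the operator `A` on `L²(X, μ)`: it is measurable and
nonnegative `μ × μ`-almost everywhere, and for every `f` and almost every `x` the function
`y ↦ a(x, y) f(y)` is integrable with integral `(A f)(x)`. -/
structure HasNonnegKernel (A : L2Op μ) (a : X → X → ℝ) : Prop where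
  aemeasurable : AEMeasurable (Function.uncurry a) (μ.prod μ)
  nonneg : ∀ᵐ p ∂(μ.prod μ), 0 ≤ a p.1 p.2
  integrable : ∀ f : Lp ℂ 2 μ, ∀ᵐ x ∂μ, Integrable (fun y => (a x y : ℂ) * f y) μ
  apply_eq : ∀ f : Lp ℂ 2 μ, ∀ᵐ x ∂μ, A f x = ∫ y, (a x y : ℂ) * f y ∂μ

/-- Positive kernel operators on `L²(X, μ)`. For the counting measure on a countable set these
are the operators on `ℓ²` that are defined by nonnegative matrices. -/
def IsPositiveKernelOperator (A : L2Op μ) : Prop := ∃ a : X → X → ℝ, HasNonnegKernel A a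

/-- Bounded sets of positive kernel operators. -/
structure IsBoundedPositiveKernelSet (S : Set (L2Op μ)) : Prop where
  bounded : Bornology.IsBounded S
  kernel : ∀ A ∈ S, IsPositiveKernelOperator A

/-- `S^* = {A^* : A ∈ S}`. -/
noncomputable def adjointSet (S : Set (L2Op μ)) : Set (L2Op μ) :=
  (fun A : L2Op μ => ContinuousLinearMap.adjoint A) '' S

/-- `C = A₁^(α) ∘ ⋯ ∘ A_m^(α)`: the operator `C` has the kernel `∏ⱼ aⱼ(x, y)^α`, where `aⱼ` is
the kernel of `Aⱼ`. -/
def IsHadamardPowerProduct {m : ℕ} (α : ℝ) (A : Fin m → L2Op μ) (C : L2Op μ) : Prop :=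
  ∃ a : Fin m → X → X → ℝ, (∀ j, HasNonnegKernel (A j) (a j)) ∧
    HasNonnegKernel C (fun x y => ∏ j, a j x y ^ α)

/-- The set `Ψ₁^(α) ∘ ⋯ ∘ Ψ_m^(α) = {A₁^(α) ∘ ⋯ ∘ A_m^(α) : A₁ ∈ Ψ₁, …, A_m ∈ Ψ_m}`. -/
def hadamardSet {m : ℕ} (α : ℝ) (Ψ : Fin m → Set (L2Op μ)) : Set (L2Op μ) :=
  {C | ∃ A : Fin m → L2Op μ, (∀ j, A j ∈ Ψ j) ∧ IsHadamardPowerProduct α A C}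

/-- `Ψ₁^(α) ∘ ⋯ ∘ Ψ_m^(α)` makes sense as a bounded set of positive kernel operators: every
`A₁^(α) ∘ ⋯ ∘ A_m^(α)` with `Aⱼ ∈ Ψⱼ` is an operator on the whole of `L²(X, μ)`, and together
these operators form a bounded set. -/
structure HadamardSetDefined {m : ℕ} (α : ℝ) (Ψ : Fin m → Set (L2Op μ)) : Prop where
  exists_product : ∀ A : Fin m → L2Op μ, (∀ j, A j ∈ Ψ j) → ∃ C, IsHadamardPowerProduct α A C
  boundedSet : IsBoundedPositiveKernelSet (hadamardSet α Ψ)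

/-- The sets `Σⱼ = Ψ_{τ(2j-1)}^* Ψ_{τ(2j)}` and `Σ_{m/2+j} = Ψ_{τ(2j)}^* Ψ_{τ(2j-1)}` for
`j = 1, …, m/2`. The indices in the code start at `0`. -/
noncomputable def sigmaFamily {m : ℕ} (hm : Even m) (τ : Equiv.Perm (Fin m))
    (Ψ : Fin m → Set (L2Op μ)) (i : Fin m) : Set (L2Op μ) :=
  if h : (i : ℕ) < m / 2 then
    adjointSet (Ψ (τ ⟨2 * i, by omega⟩)) *
      Ψ (τ ⟨2 * i + 1, by omega⟩)
  else
    adjointSet (Ψ (τ ⟨2 * (i - m / 2) + 1, by have := i.isLt; obtain ⟨k, rfl⟩ := hm; omega⟩)) *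
      Ψ (τ ⟨2 * (i - m / 2), by have := i.isLt; obtain ⟨k, rfl⟩ := hm; omega⟩)

/-- The product `Σ_{ν(1)} Σ_{ν(2)} ⋯ Σ_{ν(m)}`. -/
noncomputable def orderedProduct {m : ℕ} (ν : Equiv.Perm (Fin m))
    (S : Fin m → Set (L2Op μ)) : Set (L2Op μ) :=
  (List.ofFn fun k => S (ν k)).prod

/-- The cyclically shifted products `Ωᵢ = Σ_{ν(i)} ⋯ Σ_{ν(m)} Σ_{ν(1)} ⋯ Σ_{ν(i-1)}`, with
indices in the code starting at `0`. -/
noncomputable def omegaFamily {m : ℕ} (ν : Equiv.Perm (Fin m))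
    (S : Fin m → Set (L2Op μ)) (i : Fin m) : Set (L2Op μ) :=
  ((List.ofFn fun k => S (ν k)).rotate i).prod

end Kernels

end KernelOperators

/-!
The whole chain rests on two facts about an exponent `α`, collected in `IsHadamardExponent`: the
inequality `∫ ∏ⱼ fⱼ^α ≤ ∏ⱼ (∫ fⱼ)^α`, and the norm estimate `‖∘ⱼ Aⱼ^(α)‖ ≤ ∏ⱼ ‖Aⱼ‖^α`. For
`α = 1 / m` both are Hölder's inequality (`isHadamardExponent_one_div`). For the counting measure
they extend to `α ≥ 1 / m`, because `∑ uᵗ ≤ (∑ u)ᵗ` for `t ≥ 1` and because the entries of a matrix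
are bounded by its norm (`isHadamardExponent_count`).

The first fact, applied to the integral over the intermediate variable, gives
`(∘ⱼ Aⱼ^(α)) (∘ⱼ Bⱼ^(α)) ≤ ∘ⱼ (Aⱼ Bⱼ)^(α)` for kernels (`IsHadamardPowerProduct.mul`), and here the
factors of each Hadamard product may be permuted beforehand. Domination of kernels is expressed by
`IsDominatedBy`, under which norms and spectral radii are monotone. Then

* for `C = ∘ⱼ Aⱼ^(α)` one has `‖C‖² = ρ(C* C)`, and `C* C` is dominated by an element of
  `∘ⱼ Σⱼ^(α)` (`setNorm_hadamardSet_sq_le`);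
* a product of `m` elements of `∘ⱼ Σⱼ^(α)` is dominated by an element of `∘ᵢ Ωᵢ^(α)`, since the
  `k`-th factor can be written with its positions shifted cyclically by `k`
  (`hadamardSet_pow_isSetDominatedBy`); moreover `r(Ψ)^m ≤ r(Ψ^m)`;
* `r(∘ᵢ Ωᵢ^(α)) ≤ r(Σ_{ν(1)} ⋯ Σ_{ν(m)})^(m α)` by the norm estimate applied to powers
  (`jointSpectralRadius_hadamardSet_le`, `generalizedSpectralRadius_hadamardSet_le`) and by the
  invariance of `r` under cyclic permutation of factors.

Spectral radii of single operators are treated as joint spectral radii of singletons, by Gelfand's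
formula. Kernels are handled as measurable functions with values in `[0, ∞]` (`HasENNKernel`), so
that Tonelli's theorem yields the kernels of products and adjoints.
-/

open MeasureTheory Filter
open scoped ENNReal Pointwise

namespace KernelOperators

/-! ### Spectral radii of sets in a Banach algebra -/

section SpectralRadii

variable {B : Type*} [NormedRing B]

theorem enorm_le_setNorm {S : Set B} {A : B} (hA : A ∈ S) : ‖A‖ₑ ≤ setNorm S :=
  le_iSup₂ (f := fun A (_ : A ∈ S) => ‖A‖ₑ) A hA

theorem setNorm_le {S : Set B} {c : ℝ≥0∞} (h : ∀ A ∈ S, ‖A‖ₑ ≤ c) : setNorm S ≤ c :=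
  iSup₂_le h

theorem setNorm_singleton (A : B) : setNorm ({A} : Set B) = ‖A‖ₑ := by
  simp [setNorm]

theorem setNorm_mono {S T : Set B} (h : S ⊆ T) : setNorm S ≤ setNorm T :=
  setNorm_le fun _ hA => enorm_le_setNorm (h hA)

theorem enorm_mul_le_mul_enorm (a b : B) : ‖a * b‖ₑ ≤ ‖a‖ₑ * ‖b‖ₑ := by
  simp only [enorm_eq_nnnorm]
  exact_mod_cast nnnorm_mul_le a b

theorem setNorm_mul_le (S T : Set B) : setNorm (S * T) ≤ setNorm S * setNorm T := by
  refine setNorm_le fun A hA => ?_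
  obtain ⟨a, ha, b, hb, rfl⟩ := Set.mem_mul.1 hA
  exact (enorm_mul_le_mul_enorm a b).trans
    (mul_le_mul' (enorm_le_setNorm ha) (enorm_le_setNorm hb))

theorem setNorm_pow_ne_top {S : Set B} (hS : setNorm S ≠ ⊤) (n : ℕ) : setNorm (S ^ n) ≠ ⊤ := by
  induction n with
  | zero => rw [pow_zero, ← Set.singleton_one, setNorm_singleton]; exact enorm_ne_top
  | succ n ih =>
    rw [pow_succ]
    exact ((setNorm_mul_le _ _).trans_lt (ENNReal.mul_lt_top ih.lt_top hS.lt_top)).ne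

theorem isBounded_iff_setNorm_ne_top {S : Set B} :
    Bornology.IsBounded S ↔ setNorm S ≠ ⊤ := by
  rw [isBounded_iff_forall_norm_le]
  constructor
  · rintro ⟨C, hC⟩
    refine ((setNorm_le (c := ENNReal.ofReal C) fun A hA => ?_).trans_lt ENNReal.ofReal_lt_top).ne
    rw [← ofReal_norm]
    exact ENNReal.ofReal_le_ofReal (hC A hA)
  · intro h
    refine ⟨(setNorm S).toReal, fun A hA => ?_⟩
    rw [← toReal_enorm]
    exact ENNReal.toReal_mono h (enorm_le_setNorm hA)

theorem setNorm_list_prod_ne_top {l : List (Set B)} (hl : ∀ S ∈ l, setNorm S ≠ ⊤) :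
    setNorm l.prod ≠ ⊤ := by
  induction l with
  | nil =>
    rw [List.prod_nil, ← Set.singleton_one, setNorm_singleton]; exact enorm_ne_top
  | cons S l ih =>
    rw [List.prod_cons]
    refine ((setNorm_mul_le _ _).trans_lt (ENNReal.mul_lt_top (hl S (by simp)).lt_top ?_)).ne
    exact (ih fun T hT => hl T (by simp [hT])).lt_top

/-- Together with `jointSpectralRadius_le_of_bound`, this says that the joint spectral radius of a
bounded set is the infimum of the growth rates `b` for which `‖Sⁿ‖ ≤ M bⁿ` for some constant
`M`. -/
theorem exists_bound_of_jointSpectralRadius_lt {S : Set B} (hS : setNorm S ≠ ⊤) {b : ℝ≥0∞}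
    (hb : jointSpectralRadius S < b) (hbt : b ≠ ⊤) :
    ∃ M : ℝ≥0∞, M ≠ ⊤ ∧ ∀ n, setNorm (S ^ n) ≤ M * b ^ n := by
  have hb0 : b ≠ 0 := (bot_le.trans_lt hb).ne'
  obtain ⟨N, hN⟩ := eventually_atTop.1 (eventually_lt_of_limsup_lt hb)
  refine ⟨1 + ∑ k ∈ Finset.range (N + 1), setNorm (S ^ k) / b ^ k, ?_, fun n => ?_⟩
  · refine ENNReal.add_ne_top.2 ⟨ENNReal.one_ne_top, ENNReal.sum_ne_top.2 fun k _ => ?_⟩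
    exact ENNReal.div_ne_top (setNorm_pow_ne_top hS k) (pow_ne_zero _ hb0)
  · have hbn0 : b ^ n ≠ 0 := pow_ne_zero _ hb0
    have hbnt : b ^ n ≠ ⊤ := ENNReal.pow_ne_top hbt
    by_cases hn : n ≤ N
    · calc setNorm (S ^ n) = setNorm (S ^ n) / b ^ n * b ^ n :=
            (ENNReal.div_mul_cancel hbn0 hbnt).symm
        _ ≤ _ := by
          gcongr
          refine le_add_left ?_
          exact Finset.single_le_sum (f := fun k => setNorm (S ^ k) / b ^ k)
            (fun _ _ => zero_le) (Finset.mem_range.2 (Nat.lt_succ_of_le hn))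
    · have hn0 : (0 : ℝ) < n := by
        have : 0 < n := by omega
        exact_mod_cast this
      have h := (hN n (by omega)).le
      rw [one_div, ENNReal.rpow_inv_le_iff hn0, ENNReal.rpow_natCast] at h
      calc setNorm (S ^ n) ≤ 1 * b ^ n := by simpa using h
        _ ≤ _ := by gcongr; exact le_self_add

theorem jointSpectralRadius_le_of_bound {S : Set B} {b M : ℝ≥0∞} (hM : M ≠ ⊤)
    (h : ∀ n, 0 < n → setNorm (S ^ n) ≤ M * b ^ n) : jointSpectralRadius S ≤ b := by
  refine le_of_forall_gt_imp_ge_of_dense fun c hbc => ?_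
  rcases eq_or_ne c ⊤ with rfl | hct
  · exact le_top
  lift c to NNReal using hct
  lift b to NNReal using (hbc.trans_le le_top).ne
  lift M to NNReal using hM
  have hbc' : b < c := by exact_mod_cast hbc
  have hc0 : 0 < c := bot_le.trans_lt hbc'
  have ht : Tendsto (fun n : ℕ => M * (b / c) ^ n) atTop (nhds (M * 0)) :=
    (NNReal.tendsto_pow_atTop_nhds_zero_of_lt_one
      ((div_lt_one hc0).2 hbc')).const_mul M
  rw [mul_zero] at ht
  refine limsup_le_of_le (h := ?_)
  filter_upwards [ht.eventually (gt_mem_nhds zero_lt_one), eventually_gt_atTop 0] with n hn hn0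
  have hn0' : (0 : ℝ) < n := by exact_mod_cast hn0
  rw [one_div, ENNReal.rpow_inv_le_iff hn0', ENNReal.rpow_natCast]
  refine (h n hn0).trans ?_
  have : M * b ^ n ≤ c ^ n := by
    rw [div_pow, ← mul_div_assoc, div_lt_one (by positivity)] at hn
    exact hn.le
  exact_mod_cast this

theorem jointSpectralRadius_mono_of_setNorm {S T : Set B}
    (h : ∀ n, 0 < n → setNorm (S ^ n) ≤ setNorm (T ^ n)) :
    jointSpectralRadius S ≤ jointSpectralRadius T := by
  refine limsup_le_limsup ?_
  filter_upwards [eventually_gt_atTop 0] with n hn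
  exact ENNReal.rpow_le_rpow (h n hn) (by positivity)

theorem jointSpectralRadius_pow_le {S : Set B} (hS : setNorm S ≠ ⊤) {m : ℕ} (hm : 0 < m) :
    jointSpectralRadius S ^ m ≤ jointSpectralRadius (S ^ m) := by
  refine le_of_forall_gt_imp_ge_of_dense fun b hb => ?_
  rcases eq_or_ne b ⊤ with rfl | hbt
  · exact le_top
  have hm' : (0 : ℝ) < m := by exact_mod_cast hm
  obtain ⟨M, hM, hMb⟩ :=
    exists_bound_of_jointSpectralRadius_lt (setNorm_pow_ne_top hS m) hb hbt
  have hb0 : b ≠ 0 := (bot_le.trans_lt hb).ne'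
  set c : ℝ≥0∞ := b ^ (1 / (m : ℝ)) with hc
  have hcm : c ^ m = b := by
    rw [hc, ← ENNReal.rpow_natCast, ← ENNReal.rpow_mul, one_div,
      inv_mul_cancel₀ hm'.ne', ENNReal.rpow_one]
  have hc0 : c ≠ 0 := by rintro h; rw [h, zero_pow hm.ne'] at hcm; exact hb0 hcm.symm
  have hct : c ≠ ⊤ := by rintro h; rw [h, ENNReal.top_pow hm.ne'] at hcm; exact hbt hcm.symm
  suffices jointSpectralRadius S ≤ c by
    calc jointSpectralRadius S ^ m ≤ c ^ m := by gcongr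
      _ = b := hcm
  -- Division with remainder: `n = m q + s` with `s < m`, and finitely many `s` are absorbed
  -- into the constant.
  refine jointSpectralRadius_le_of_bound
    (M := M * ∑ s ∈ Finset.range m, setNorm (S ^ s) / c ^ s) ?_ fun n _ => ?_
  · refine ENNReal.mul_ne_top hM (ENNReal.sum_ne_top.2 fun k _ => ?_)
    exact ENNReal.div_ne_top (setNorm_pow_ne_top hS k) (pow_ne_zero _ hc0)
  · have hs : n % m < m := Nat.mod_lt _ hm
    calc setNorm (S ^ n) = setNorm ((S ^ m) ^ (n / m) * S ^ (n % m)) := by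
          rw [← pow_mul, ← pow_add, Nat.div_add_mod]
      _ ≤ M * b ^ (n / m) * setNorm (S ^ (n % m)) :=
          (setNorm_mul_le _ _).trans (mul_le_mul' (hMb _) le_rfl)
      _ = M * (setNorm (S ^ (n % m)) / c ^ (n % m)) * c ^ n := by
          conv_rhs => rw [← Nat.div_add_mod n m, pow_add, pow_mul, hcm, Nat.div_add_mod]
          rw [mul_assoc, mul_assoc, mul_comm (b ^ _) (c ^ _), ← mul_assoc (_ / _),
            ENNReal.div_mul_cancel (pow_ne_zero _ hc0) (ENNReal.pow_ne_top hct),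
            mul_comm (b ^ _)]
      _ ≤ _ := by
          gcongr
          exact Finset.single_le_sum (f := fun k => setNorm (S ^ k) / c ^ k)
            (fun _ _ => zero_le) (Finset.mem_range.2 hs)

theorem mul_pow_succ_eq (S T : Set B) (n : ℕ) :
    (S * T) ^ (n + 1) = S * ((T * S) ^ n * T) := by
  induction n with
  | zero => simp
  | succ n ih => rw [pow_succ, ih, pow_succ (T * S)]; simp only [mul_assoc]

theorem jointSpectralRadius_mul_comm_le {S T : Set B} (hS : setNorm S ≠ ⊤) (hT : setNorm T ≠ ⊤) :
    jointSpectralRadius (S * T) ≤ jointSpectralRadius (T * S) := by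
  refine le_of_forall_gt_imp_ge_of_dense fun b hb => ?_
  rcases eq_or_ne b ⊤ with rfl | hbt
  · exact le_top
  have hb0 : b ≠ 0 := (bot_le.trans_lt hb).ne'
  have hTS : setNorm (T * S) ≠ ⊤ :=
    ((setNorm_mul_le _ _).trans_lt (ENNReal.mul_lt_top hT.lt_top hS.lt_top)).ne
  obtain ⟨M, hM, hMb⟩ := exists_bound_of_jointSpectralRadius_lt hTS hb hbt
  refine jointSpectralRadius_le_of_bound (M := setNorm S * (M * setNorm T) / b) ?_ ?_
  · exact ENNReal.div_ne_top (ENNReal.mul_ne_top hS (ENNReal.mul_ne_top hM hT)) hb0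
  · intro n hn
    obtain ⟨n, rfl⟩ : ∃ k, n = k + 1 := ⟨n - 1, by omega⟩
    rw [mul_pow_succ_eq]
    calc setNorm (S * ((T * S) ^ n * T)) ≤ setNorm S * (M * b ^ n * setNorm T) :=
          (setNorm_mul_le _ _).trans (mul_le_mul' le_rfl
            ((setNorm_mul_le _ _).trans (mul_le_mul' (hMb n) le_rfl)))
      _ = setNorm S * (M * setNorm T) / b * b * b ^ n := by
          rw [ENNReal.div_mul_cancel hb0 hbt]; ring
      _ = _ := by rw [pow_succ]; ring

theorem setNorm_singleton_ne_top (A : B) : setNorm ({A} : Set B) ≠ ⊤ := by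
  rw [setNorm_singleton]; exact enorm_ne_top

variable [NormedAlgebra ℂ B]

theorem generalizedSpectralRadius_le_of_bound {S : Set B} {c : ℝ≥0∞}
    (h : ∀ n, 0 < n → ∀ A ∈ S ^ n, spectralRadius ℂ A ≤ c ^ n) :
    generalizedSpectralRadius S ≤ c := by
  refine limsup_le_of_le (h := ?_)
  filter_upwards [eventually_gt_atTop 0] with n hn
  rw [one_div, ENNReal.rpow_inv_le_iff (by exact_mod_cast hn), ENNReal.rpow_natCast]
  exact iSup₂_le (h n hn)

variable [CompleteSpace B]

/-- Gelfand's formula. -/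
theorem jointSpectralRadius_singleton (A : B) :
    jointSpectralRadius ({A} : Set B) = spectralRadius ℂ A := by
  have := (spectrum.pow_nnnorm_pow_one_div_tendsto_nhds_spectralRadius A).limsup_eq
  rw [← this]
  simp only [jointSpectralRadius, Set.singleton_pow, setNorm_singleton, enorm_eq_nnnorm]

theorem spectralRadius_pow_le (A : B) {m : ℕ} (hm : 0 < m) :
    spectralRadius ℂ A ^ m ≤ spectralRadius ℂ (A ^ m) := by
  simpa only [jointSpectralRadius_singleton, Set.singleton_pow] using
    jointSpectralRadius_pow_le (setNorm_singleton_ne_top A) hm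

theorem spectralRadius_mul_comm_le (A C : B) :
    spectralRadius ℂ (A * C) ≤ spectralRadius ℂ (C * A) := by
  simpa only [Set.singleton_mul_singleton, jointSpectralRadius_singleton] using
    jointSpectralRadius_mul_comm_le (setNorm_singleton_ne_top A) (setNorm_singleton_ne_top C)

theorem spectralRadius_le_enorm (A : B) : spectralRadius ℂ A ≤ ‖A‖ₑ := by
  rw [← jointSpectralRadius_singleton]
  refine jointSpectralRadius_le_of_bound ENNReal.one_ne_top fun n hn => ?_
  rw [Set.singleton_pow, setNorm_singleton, one_mul]
  simp only [enorm_eq_nnnorm]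
  exact_mod_cast nnnorm_pow_le' A hn

/-- The spectral radii of the powers `Aᵏ ∈ Sⁿᵏ` give a subsequence along which the defining
upper limit is at least `ρ(A)^(1/n)`. -/
theorem spectralRadius_le_generalizedSpectralRadius_pow {S : Set B} {n : ℕ} (hn : 0 < n) {A : B}
    (hA : A ∈ S ^ n) : spectralRadius ℂ A ≤ generalizedSpectralRadius S ^ n := by
  have hn' : (0 : ℝ) < n := by exact_mod_cast hn
  rw [← ENNReal.rpow_natCast, ← ENNReal.rpow_inv_le_iff hn']
  refine le_limsup_of_frequently_le (frequently_atTop.2 fun N => ?_)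
  refine ⟨n * (N + 1), by nlinarith, ?_⟩
  have hk : (0 : ℝ) < (N + 1 : ℕ) := by positivity
  have hmem : A ^ (N + 1) ∈ S ^ (n * (N + 1)) := by
    rw [pow_mul]; exact Set.pow_mem_pow hA
  calc spectralRadius ℂ A ^ ((n : ℝ)⁻¹)
      = (spectralRadius ℂ A ^ (N + 1)) ^ (1 / ((n * (N + 1) : ℕ) : ℝ)) := by
        rw [← ENNReal.rpow_natCast, ← ENNReal.rpow_mul]
        congr 1
        push_cast at hk ⊢
        field_simp
    _ ≤ _ := by
        gcongr
        exact (spectralRadius_pow_le A (Nat.succ_pos N)).trans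
          (le_iSup₂ (f := fun C (_ : C ∈ S ^ (n * (N + 1))) => spectralRadius ℂ C) _ hmem)

theorem generalizedSpectralRadius_pow_le (S : Set B) {m : ℕ} (hm : 0 < m) :
    generalizedSpectralRadius S ^ m ≤ generalizedSpectralRadius (S ^ m) := by
  have hm' : (0 : ℝ) < m := by exact_mod_cast hm
  rw [← ENNReal.rpow_natCast, ← ENNReal.le_rpow_inv_iff hm']
  refine generalizedSpectralRadius_le_of_bound fun n hn A hA => ?_
  rw [← ENNReal.rpow_natCast, ← ENNReal.rpow_mul, mul_comm, ENNReal.rpow_mul,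
    ENNReal.le_rpow_inv_iff hm', ENNReal.rpow_natCast, ENNReal.rpow_natCast]
  refine (spectralRadius_pow_le A hm).trans
    (spectralRadius_le_generalizedSpectralRadius_pow hn ?_)
  rw [← pow_mul, mul_comm, pow_mul]
  exact Set.pow_mem_pow hA

theorem generalizedSpectralRadius_le_jointSpectralRadius (S : Set B) :
    generalizedSpectralRadius S ≤ jointSpectralRadius S := by
  refine limsup_le_limsup (Eventually.of_forall fun n => ?_)
  refine ENNReal.rpow_le_rpow ?_ (by positivity)
  exact iSup₂_mono fun A _ => spectralRadius_le_enorm A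

/-- Cyclic permutation of the factors preserves the spectral radii occurring in `(S T)ⁿ`. -/
theorem exists_mem_mul_comm_pow {S T : Set B} {n : ℕ} (hn : 0 < n) {A : B}
    (hA : A ∈ (S * T) ^ n) : ∃ C ∈ (T * S) ^ n, spectralRadius ℂ A ≤ spectralRadius ℂ C := by
  obtain ⟨n, rfl⟩ : ∃ k, n = k + 1 := ⟨n - 1, by omega⟩
  rw [mul_pow_succ_eq] at hA
  obtain ⟨s, hs, z, hz, rfl⟩ := Set.mem_mul.1 hA
  refine ⟨z * s, ?_, spectralRadius_mul_comm_le s z⟩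
  rw [pow_succ, ← mul_assoc]
  exact Set.mul_mem_mul hz hs

end SpectralRadii

/-! ### Domination of operators on `L²` -/

section Domination

open scoped ComplexOrder

variable {X : Type*} [MeasurableSpace X] {μ : Measure X}

/-- The absolute value of a function in `L²`, again as an element of the complex space `L²`. -/
noncomputable def absLp (f : Lp ℂ 2 μ) : Lp ℂ 2 μ :=
  ((Lp.memLp f).norm.ofReal (K := ℂ)).toLp _

theorem coeFn_absLp (f : Lp ℂ 2 μ) : ∀ᵐ x ∂μ, absLp f x = (‖f x‖ : ℂ) :=
  MemLp.coeFn_toLp _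

theorem norm_absLp (f : Lp ℂ 2 μ) : ‖absLp f‖ = ‖f‖ := by
  refine le_antisymm (Lp.norm_le_norm_of_ae_le ?_) (Lp.norm_le_norm_of_ae_le ?_) <;>
    filter_upwards [coeFn_absLp f] with x hx <;> simp [hx]

theorem absLp_nonneg (f : Lp ℂ 2 μ) : ∀ᵐ x ∂μ, 0 ≤ absLp f x := by
  filter_upwards [coeFn_absLp f] with x hx
  rw [hx]
  exact_mod_cast norm_nonneg _

theorem eq_coe_norm_of_nonneg {z : ℂ} (hz : 0 ≤ z) : z = (‖z‖ : ℂ) :=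
  (RCLike.norm_of_nonneg' hz).symm

/-- `A` is dominated by `B` if `|f| ≤ g` implies `|A f| ≤ B g`. In particular `B` is then a
positive operator. The inequalities are in the order of `ℂ`, so they say that `g` and `B g` are
real. For kernel operators domination is the inequality between the absolute value of the kernel
of `A` and the kernel of `B`. -/
def IsDominatedBy (A B : L2Op μ) : Prop :=
  ∀ f g : Lp ℂ 2 μ, (∀ᵐ x ∂μ, (‖f x‖ : ℂ) ≤ g x) → ∀ᵐ x ∂μ, (‖A f x‖ : ℂ) ≤ B g x

theorem IsDominatedBy.trans {A B C : L2Op μ} (h₁ : IsDominatedBy A B) (h₂ : IsDominatedBy B C) :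
    IsDominatedBy A C := by
  intro f g hfg
  have hgg : ∀ᵐ x ∂μ, (‖g x‖ : ℂ) ≤ g x := by
    filter_upwards [hfg] with x hx
    have : (0 : ℂ) ≤ g x := le_trans (by exact_mod_cast norm_nonneg _) hx
    exact (eq_coe_norm_of_nonneg this).ge
  filter_upwards [h₁ f g hfg, h₂ g g hgg] with x h1 h2
  have : (0 : ℂ) ≤ B g x := le_trans (by exact_mod_cast norm_nonneg _) h1
  exact h1.trans ((eq_coe_norm_of_nonneg this).le.trans h2)

theorem IsDominatedBy.mul {A B C D : L2Op μ} (h₁ : IsDominatedBy A B) (h₂ : IsDominatedBy C D) :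
    IsDominatedBy (A * C) (B * D) :=
  fun f g hfg => h₁ _ _ (h₂ f g hfg)

theorem isDominatedBy_one : IsDominatedBy (1 : L2Op μ) 1 := fun _ _ hfg => hfg

theorem IsDominatedBy.pow {A B : L2Op μ} (h : IsDominatedBy A B) (n : ℕ) :
    IsDominatedBy (A ^ n) (B ^ n) := by
  induction n with
  | zero => exact isDominatedBy_one
  | succ n ih => rw [pow_succ, pow_succ]; exact ih.mul h

theorem IsDominatedBy.enorm_le {A B : L2Op μ} (h : IsDominatedBy A B) : ‖A‖ₑ ≤ ‖B‖ₑ := by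
  suffices ‖A‖ ≤ ‖B‖ from enorm_le_iff_norm_le.2 this
  refine ContinuousLinearMap.opNorm_le_bound _ (norm_nonneg _) fun f => ?_
  have hf : ∀ᵐ x ∂μ, (‖f x‖ : ℂ) ≤ absLp f x := by
    filter_upwards [coeFn_absLp f] with x hx using hx.ge
  calc ‖A f‖ ≤ ‖B (absLp f)‖ := by
        refine Lp.norm_le_norm_of_ae_le ?_
        filter_upwards [h f _ hf] with x hx
        have h0 : (0 : ℂ) ≤ B (absLp f) x := le_trans (by exact_mod_cast norm_nonneg _) hx
        rw [eq_coe_norm_of_nonneg h0] at hx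
        exact_mod_cast hx
    _ ≤ ‖B‖ * ‖f‖ := by
        rw [← norm_absLp f]
        exact B.le_opNorm _

theorem IsDominatedBy.spectralRadius_le {A B : L2Op μ} (h : IsDominatedBy A B) :
    spectralRadius ℂ A ≤ spectralRadius ℂ B := by
  rw [← jointSpectralRadius_singleton, ← jointSpectralRadius_singleton]
  refine jointSpectralRadius_mono_of_setNorm fun n _ => ?_
  simp only [Set.singleton_pow, setNorm_singleton]
  exact (h.pow n).enorm_le

/-- Every element of `S` is dominated by an element of `T`. -/
def IsSetDominatedBy (S T : Set (L2Op μ)) : Prop := ∀ A ∈ S, ∃ B ∈ T, IsDominatedBy A B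

theorem IsSetDominatedBy.pow {S T : Set (L2Op μ)} (h : IsSetDominatedBy S T) (n : ℕ) :
    IsSetDominatedBy (S ^ n) (T ^ n) := by
  induction n with
  | zero =>
    intro A hA
    rw [pow_zero, Set.mem_one] at hA
    exact ⟨1, by simp, hA ▸ isDominatedBy_one⟩
  | succ n ih =>
    intro A hA
    rw [pow_succ] at hA
    obtain ⟨A₁, h₁, A₂, h₂, rfl⟩ := Set.mem_mul.1 hA
    obtain ⟨B₁, hB₁, hd₁⟩ := ih A₁ h₁
    obtain ⟨B₂, hB₂, hd₂⟩ := h A₂ h₂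
    exact ⟨B₁ * B₂, by rw [pow_succ]; exact Set.mul_mem_mul hB₁ hB₂, hd₁.mul hd₂⟩

theorem IsSetDominatedBy.jointSpectralRadius_le {S T : Set (L2Op μ)} (h : IsSetDominatedBy S T) :
    jointSpectralRadius S ≤ jointSpectralRadius T := by
  refine jointSpectralRadius_mono_of_setNorm fun n _ => setNorm_le fun A hA => ?_
  obtain ⟨B, hB, hd⟩ := h.pow n A hA
  exact hd.enorm_le.trans (enorm_le_setNorm hB)

theorem IsSetDominatedBy.generalizedSpectralRadius_le {S T : Set (L2Op μ)}
    (h : IsSetDominatedBy S T) : generalizedSpectralRadius S ≤ generalizedSpectralRadius T := by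
  refine generalizedSpectralRadius_le_of_bound fun n hn A hA => ?_
  obtain ⟨B, hB, hd⟩ := h.pow n A hA
  exact hd.spectralRadius_le.trans (spectralRadius_le_generalizedSpectralRadius_pow hn hB)

end Domination

/-! ### Kernels with values in `[0, ∞]` -/

section NonnegKernels

open scoped ComplexOrder

variable {X : Type*} [MeasurableSpace X] {μ : Measure X}

theorem enorm_complex_ofReal (r : ℝ) : ‖(r : ℂ)‖ₑ = ‖r‖ₑ := by
  rw [← ofReal_norm, ← ofReal_norm, Complex.norm_real]

theorem enorm_Lp_sq (f : Lp ℂ 2 μ) : ‖f‖ₑ ^ 2 = ∫⁻ x, ‖f x‖ₑ ^ 2 ∂μ := by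
  rw [Lp.enorm_def, eLpNorm_eq_lintegral_rpow_enorm_toReal (by simp) (by simp)]
  simp only [ENNReal.toReal_ofNat, ← ENNReal.rpow_natCast, ← ENNReal.rpow_mul]
  norm_num

theorem memLp_two_of_lintegral_sq_ne_top {f : X → ℂ} (hf : AEStronglyMeasurable f μ)
    (h : ∫⁻ x, ‖f x‖ₑ ^ 2 ∂μ ≠ ⊤) : MemLp f 2 μ := by
  refine ⟨hf, ?_⟩
  rw [eLpNorm_eq_lintegral_rpow_enorm_toReal (by simp) (by simp)]
  refine ENNReal.rpow_lt_top_of_nonneg (by simp) ?_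
  simpa using h

/-- `A` is the operator with the everywhere measurable, `[0, ∞]`-valued kernel `k`. Such kernels
can be multiplied, composed and raised to powers without any condition of finiteness, and it
suffices to test them on nonnegative functions. -/
structure HasENNKernel (A : L2Op μ) (k : X → X → ℝ≥0∞) : Prop where
  measurable : Measurable (Function.uncurry k)
  nonneg_and_apply : ∀ F : Lp ℂ 2 μ, (∀ᵐ y ∂μ, 0 ≤ F y) →
    ∀ᵐ x ∂μ, 0 ≤ A F x ∧ ‖A F x‖ₑ = ∫⁻ y, k x y * ‖F y‖ₑ ∂μ

/-- `k` is the kernel of an operator on `L²` of norm at most `M`. -/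
structure IsENNKernelBound (μ : Measure X) (k : X → X → ℝ≥0∞) (M : ℝ≥0∞) : Prop where
  measurable : Measurable (Function.uncurry k)
  bound : ∀ F : Lp ℂ 2 μ, ∫⁻ x, (∫⁻ y, k x y * ‖F y‖ₑ ∂μ) ^ 2 ∂μ ≤ (M * ‖F‖ₑ) ^ 2

theorem HasENNKernel.isENNKernelBound {A : L2Op μ} {k : X → X → ℝ≥0∞} (h : HasENNKernel A k) :
    IsENNKernelBound μ k ‖A‖ₑ := by
  refine ⟨h.measurable, fun F => ?_⟩
  have hF : ∀ x, ∫⁻ y, k x y * ‖F y‖ₑ ∂μ = ∫⁻ y, k x y * ‖absLp F y‖ₑ ∂μ := fun x => by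
    refine lintegral_congr_ae ?_
    filter_upwards [coeFn_absLp F] with y hy
    rw [hy]
    simp [enorm_eq_nnnorm]
  calc ∫⁻ x, (∫⁻ y, k x y * ‖F y‖ₑ ∂μ) ^ 2 ∂μ = ∫⁻ x, ‖A (absLp F) x‖ₑ ^ 2 ∂μ := by
        refine lintegral_congr_ae ?_
        filter_upwards [h.nonneg_and_apply _ (absLp_nonneg F)] with x hx
        rw [hx.2, hF]
    _ = ‖A (absLp F)‖ₑ ^ 2 := (enorm_Lp_sq _).symm
    _ ≤ (‖A‖ₑ * ‖F‖ₑ) ^ 2 := by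
        have : ‖F‖ₑ = ‖absLp F‖ₑ := by
          rw [← ofReal_norm, ← ofReal_norm, norm_absLp]
        rw [this]
        gcongr
        exact ContinuousLinearMap.le_opENorm A _

theorem enorm_integral_kernel_le {k : X → X → ℝ≥0∞} (x : X) (f : X → ℂ) :
    ‖∫ y, ((k x y).toReal : ℂ) * f y ∂μ‖ₑ ≤ ∫⁻ y, k x y * ‖f y‖ₑ ∂μ := by
  refine (enorm_integral_le_lintegral_enorm _).trans (lintegral_mono fun y => ?_)
  rw [enorm_mul, enorm_complex_ofReal]
  gcongr
  rw [← ofReal_norm, Real.norm_of_nonneg ENNReal.toReal_nonneg]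
  exact ENNReal.ofReal_toReal_le

section Bound

variable [SigmaFinite μ] {k : X → X → ℝ≥0∞} {M : ℝ≥0∞}

theorem measurable_lintegral_kernel (hk : Measurable (Function.uncurry k)) (f : Lp ℂ 2 μ) :
    Measurable fun x => ∫⁻ y, k x y * ‖f y‖ₑ ∂μ := by
  refine Measurable.lintegral_prod_right' (f := fun p : X × X => k p.1 p.2 * ‖f p.2‖ₑ) ?_
  exact hk.mul ((Lp.stronglyMeasurable f).measurable.enorm.comp measurable_snd)

theorem IsENNKernelBound.ae_lintegral_lt_top (h : IsENNKernelBound μ k M) (hM : M ≠ ⊤)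
    (f : Lp ℂ 2 μ) : ∀ᵐ x ∂μ, ∫⁻ y, k x y * ‖f y‖ₑ ∂μ < ⊤ := by
  have := ae_lt_top ((measurable_lintegral_kernel h.measurable f).pow_const 2)
    ((h.bound f).trans_lt (ENNReal.pow_lt_top (ENNReal.mul_lt_top hM.lt_top enorm_lt_top))).ne
  filter_upwards [this] with x hx
  by_contra hc
  rw [not_lt, top_le_iff] at hc
  simp [hc] at hx

/-- The kernel is finite almost everywhere, because it is integrable against a strictly positive
function in `L²`. -/
theorem IsENNKernelBound.ae_lt_top (h : IsENNKernelBound μ k M) (hM : M ≠ ⊤) :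
    ∀ᵐ x ∂μ, ∀ᵐ y ∂μ, k x y < ⊤ := by
  obtain ⟨w, hw, hwm, hwi⟩ := exists_pos_lintegral_lt_of_sigmaFinite μ one_ne_zero
  have hL : MemLp (fun x => ((NNReal.sqrt (w x) : ℝ) : ℂ)) 2 μ := by
    refine memLp_two_of_lintegral_sq_ne_top ?_ ?_
    · exact (Complex.measurable_ofReal.comp
        (NNReal.continuous_sqrt.measurable.comp hwm).coe_nnreal_real).aestronglyMeasurable
    · convert (hwi.trans ENNReal.one_lt_top).ne using 3 with x
      rw [enorm_complex_ofReal, ← ofReal_norm, Real.norm_of_nonneg (NNReal.coe_nonneg _),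
        ENNReal.ofReal_coe_nnreal, ← ENNReal.coe_pow, NNReal.sq_sqrt]
  filter_upwards [h.ae_lintegral_lt_top hM (hL.toLp _)] with x hx
  have hm : Measurable fun y => k x y * ‖hL.toLp _ y‖ₑ :=
    (h.measurable.comp measurable_prodMk_left).mul (Lp.stronglyMeasurable _).measurable.enorm
  filter_upwards [MeasureTheory.ae_lt_top hm hx.ne, hL.coeFn_toLp] with y hy hy'
  refine ENNReal.lt_top_of_mul_ne_top_left hy.ne ?_
  rw [hy']
  simp [(hw y).ne']

theorem IsENNKernelBound.ae_integrable (h : IsENNKernelBound μ k M) (hM : M ≠ ⊤)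
    (f : Lp ℂ 2 μ) : ∀ᵐ x ∂μ, Integrable (fun y => ((k x y).toReal : ℂ) * f y) μ := by
  filter_upwards [h.ae_lintegral_lt_top hM f] with x hx
  refine ⟨?_, lt_of_le_of_lt (lintegral_mono fun y => ?_) hx⟩
  · exact ((Complex.measurable_ofReal.comp
      (h.measurable.comp measurable_prodMk_left).ennreal_toReal).mul
      (Lp.stronglyMeasurable f).measurable).aestronglyMeasurable
  · rw [enorm_mul, enorm_complex_ofReal]
    gcongr
    rw [← ofReal_norm, Real.norm_of_nonneg ENNReal.toReal_nonneg]
    exact ENNReal.ofReal_toReal_le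

theorem IsENNKernelBound.memLp_integral (h : IsENNKernelBound μ k M) (hM : M ≠ ⊤)
    (f : Lp ℂ 2 μ) : MemLp (fun x => ∫ y, ((k x y).toReal : ℂ) * f y ∂μ) 2 μ := by
  refine memLp_two_of_lintegral_sq_ne_top ?_ ?_
  · refine AEStronglyMeasurable.integral_prod_right'
      (f := fun p : X × X => ((k p.1 p.2).toReal : ℂ) * f p.2) ?_
    exact ((Complex.measurable_ofReal.comp h.measurable.ennreal_toReal).mul
      ((Lp.stronglyMeasurable f).measurable.comp measurable_snd)).aestronglyMeasurable
  · refine ((lintegral_mono fun x => ?_).trans_lt ((h.bound f).trans_lt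
      (ENNReal.pow_lt_top (ENNReal.mul_lt_top hM.lt_top enorm_lt_top)))).ne
    gcongr
    exact enorm_integral_kernel_le x f

theorem IsENNKernelBound.exists_operator (h : IsENNKernelBound μ k M) (hM : M ≠ ⊤) :
    ∃ T : L2Op μ, HasNonnegKernel T (fun x y => (k x y).toReal) := by
  let T₀ : Lp ℂ 2 μ →ₗ[ℂ] Lp ℂ 2 μ :=
    { toFun := fun f => (h.memLp_integral hM f).toLp _
      map_add' := fun f g => by
        refine Lp.ext ?_
        filter_upwards [(h.memLp_integral hM (f + g)).coeFn_toLp,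
          (h.memLp_integral hM f).coeFn_toLp, (h.memLp_integral hM g).coeFn_toLp,
          Lp.coeFn_add ((h.memLp_integral hM f).toLp _) ((h.memLp_integral hM g).toLp _),
          h.ae_integrable hM f, h.ae_integrable hM g] with x h1 h2 h3 h4 hf hg
        rw [h1, h4, Pi.add_apply, h2, h3, ← integral_add hf hg]
        refine integral_congr_ae ?_
        filter_upwards [Lp.coeFn_add f g] with y hy
        rw [hy, Pi.add_apply, mul_add]
      map_smul' := fun c f => by
        refine Lp.ext ?_
        filter_upwards [(h.memLp_integral hM (c • f)).coeFn_toLp,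
          (h.memLp_integral hM f).coeFn_toLp,
          Lp.coeFn_smul c ((h.memLp_integral hM f).toLp _)] with x h1 h2 h3
        rw [h1, RingHom.id_apply, h3, Pi.smul_apply, h2, smul_eq_mul, ← integral_const_mul]
        refine integral_congr_ae ?_
        filter_upwards [Lp.coeFn_smul c f] with y hy
        rw [hy, Pi.smul_apply, smul_eq_mul]
        ring }
  have hT : ∀ f, ∀ᵐ x ∂μ, T₀ f x = ∫ y, ((k x y).toReal : ℂ) * f y ∂μ := fun f =>
    (h.memLp_integral hM f).coeFn_toLp
  have hb : ∀ f, ‖T₀ f‖ ≤ M.toReal * ‖f‖ := fun f => by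
    have h2 : ‖T₀ f‖ₑ ^ 2 ≤ (M * ‖f‖ₑ) ^ 2 := by
      rw [enorm_Lp_sq]
      refine (lintegral_mono_ae ?_).trans (h.bound f)
      filter_upwards [hT f] with x hx
      rw [hx]
      gcongr
      exact enorm_integral_kernel_le x f
    have h3 : ‖T₀ f‖ₑ ≤ M * ‖f‖ₑ := (ENNReal.pow_le_pow_left_iff two_ne_zero).1 h2
    rw [← toReal_enorm (T₀ f), ← toReal_enorm f, ← ENNReal.toReal_mul]
    exact ENNReal.toReal_mono (ENNReal.mul_ne_top hM enorm_ne_top) h3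
  exact ⟨T₀.mkContinuous _ hb, h.measurable.ennreal_toReal.aemeasurable,
    Eventually.of_forall fun _ => ENNReal.toReal_nonneg, h.ae_integrable hM, hT⟩

end Bound

/-- A bounded operator on `L²` is determined by its values on nonnegative functions. -/
theorem ext_of_nonneg {A B : L2Op μ}
    (h : ∀ F : Lp ℂ 2 μ, (∀ᵐ y ∂μ, 0 ≤ F y) → A F = B F) : A = B := by
  ext1 f
  have hmem : ∀ u : ℂ, ‖u‖ = 1 → MemLp (fun x => ((max (u * f x).re 0 : ℝ) : ℂ)) 2 μ := by
    intro u hu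
    refine (Lp.memLp f).of_le ?_ (Eventually.of_forall fun x => ?_)
    · exact (Complex.measurable_ofReal.comp ((Complex.measurable_re.comp
        ((Lp.stronglyMeasurable f).measurable.const_mul u)).max
          measurable_const)).aestronglyMeasurable
    · rw [Complex.norm_real, Real.norm_of_nonneg (le_max_right _ _)]
      refine max_le ((Complex.re_le_norm _).trans ?_) (norm_nonneg _)
      rw [norm_mul, hu, one_mul]
  have hpos : ∀ u (hu : ‖u‖ = 1), A ((hmem u hu).toLp _) = B ((hmem u hu).toLp _) := by
    intro u hu
    refine h _ ?_
    filter_upwards [(hmem u hu).coeFn_toLp] with x hx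
    rw [hx]
    exact_mod_cast le_max_right _ _
  have h1 : ‖(1 : ℂ)‖ = 1 := by simp
  have h2 : ‖(-1 : ℂ)‖ = 1 := by simp
  have h3 : ‖-Complex.I‖ = 1 := by simp
  have h4 : ‖Complex.I‖ = 1 := by simp
  -- The positive and negative parts of the real and of the imaginary part of `f`.
  have hf : f = ((hmem 1 h1).toLp _ - (hmem (-1) h2).toLp _) +
      Complex.I • ((hmem (-Complex.I) h3).toLp _ - (hmem Complex.I h4).toLp _) := by
    rw [← MemLp.toLp_sub, ← MemLp.toLp_sub, ← MemLp.toLp_const_smul, ← MemLp.toLp_add]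
    refine Lp.ext ?_
    symm
    refine (MemLp.coeFn_toLp _).trans (Eventually.of_forall fun x => ?_)
    have hmax : ∀ t : ℝ, max t 0 - max (-t) 0 = t := fun t => by
      rcases le_total t 0 with ht | ht <;> simp [ht]
    apply Complex.ext
    · simp [hmax (f x).re]
    · simp [hmax (f x).im]
  rw [hf]
  simp only [map_add, map_sub, map_smul]
  rw [hpos _ h1, hpos _ h2, hpos _ h3, hpos _ h4]

theorem HasNonnegKernel.hasENNKernel [SigmaFinite μ] {A : L2Op μ} {a : X → X → ℝ}
    (h : HasNonnegKernel A a) {k : X → X → ℝ≥0∞} (hk : Measurable (Function.uncurry k))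
    (hka : ∀ᵐ p ∂μ.prod μ, k p.1 p.2 = ENNReal.ofReal (a p.1 p.2)) : HasENNKernel A k := by
  refine ⟨hk, fun F hF => ?_⟩
  filter_upwards [h.integrable F, h.apply_eq F, Measure.ae_ae_of_ae_prod h.nonneg,
    Measure.ae_ae_of_ae_prod hka] with x hi hA ha hkx
  have hre : (fun y => (a x y : ℂ) * F y) =ᵐ[μ] fun y => ((a x y * ‖F y‖ : ℝ) : ℂ) := by
    filter_upwards [hF] with y hy
    rw [Complex.ofReal_mul, ← eq_coe_norm_of_nonneg hy]
  have hi' : Integrable (fun y => a x y * ‖F y‖) μ := by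
    have := (hi.congr hre).re
    simpa using this
  have h0 : 0 ≤ᵐ[μ] fun y => a x y * ‖F y‖ := by
    filter_upwards [ha] with y hy using mul_nonneg hy (norm_nonneg _)
  have hAx : A F x = ((∫ y, a x y * ‖F y‖ ∂μ : ℝ) : ℂ) := by
    rw [hA, integral_congr_ae hre, integral_complex_ofReal]
  have hn : 0 ≤ ∫ y, a x y * ‖F y‖ ∂μ := integral_nonneg_of_ae h0
  refine ⟨by rw [hAx]; exact_mod_cast hn, ?_⟩
  rw [hAx, enorm_complex_ofReal, ← ofReal_norm, Real.norm_of_nonneg hn,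
    ofReal_integral_eq_lintegral_ofReal hi' h0]
  refine lintegral_congr_ae ?_
  filter_upwards [hkx, ha] with y hy hay
  rw [ENNReal.ofReal_mul hay, ofReal_norm, hy]

variable [SigmaFinite μ]

theorem HasNonnegKernel.exists_hasENNKernel {A : L2Op μ} {a : X → X → ℝ}
    (h : HasNonnegKernel A a) : ∃ k : X → X → ℝ≥0∞, HasENNKernel A k ∧ (∀ x y, k x y ≠ ⊤) ∧
      ∀ᵐ p ∂μ.prod μ, (k p.1 p.2).toReal = a p.1 p.2 := by
  refine ⟨fun x y => ENNReal.ofReal (h.aemeasurable.mk _ (x, y)), h.hasENNKernel ?_ ?_,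
    fun _ _ => ENNReal.ofReal_ne_top, ?_⟩
  · exact h.aemeasurable.measurable_mk.ennreal_ofReal
  · filter_upwards [h.aemeasurable.ae_eq_mk] with p hp
    rw [← hp]; rfl
  · filter_upwards [h.aemeasurable.ae_eq_mk, h.nonneg] with p hp hp0
    rw [← hp]
    exact ENNReal.toReal_ofReal hp0

theorem HasNonnegKernel.hasENNKernel_of_toReal {A : L2Op μ} {k : X → X → ℝ≥0∞}
    (h : HasNonnegKernel A fun x y => (k x y).toReal) (hk : Measurable (Function.uncurry k))
    (hfin : ∀ᵐ p ∂μ.prod μ, k p.1 p.2 < ⊤) : HasENNKernel A k := by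
  refine h.hasENNKernel hk ?_
  filter_upwards [hfin] with p hp
  exact (ENNReal.ofReal_toReal hp.ne).symm

theorem HasNonnegKernel.congr {A : L2Op μ} {a b : X → X → ℝ} (h : HasNonnegKernel A a)
    (hab : ∀ᵐ p ∂μ.prod μ, a p.1 p.2 = b p.1 p.2) : HasNonnegKernel A b := by
  have hab' := Measure.ae_ae_of_ae_prod hab
  have hc : ∀ f : Lp ℂ 2 μ, ∀ᵐ x ∂μ,
      (fun y => (a x y : ℂ) * f y) =ᵐ[μ] fun y => (b x y : ℂ) * f y := fun f => by
    filter_upwards [hab'] with x hx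
    filter_upwards [hx] with y hy
    rw [hy]
  refine ⟨h.aemeasurable.congr hab, ?_, fun f => ?_, fun f => ?_⟩
  · filter_upwards [h.nonneg, hab] with p hp hp'
    rwa [← hp']
  · filter_upwards [h.integrable f, hc f] with x hx hx' using hx.congr hx'
  · filter_upwards [h.apply_eq f, hc f] with x hx hx'
    rw [hx, integral_congr_ae hx']

theorem IsENNKernelBound.ae_prod_lt_top {k : X → X → ℝ≥0∞} {M : ℝ≥0∞}
    (h : IsENNKernelBound μ k M) (hM : M ≠ ⊤) : ∀ᵐ p ∂μ.prod μ, k p.1 p.2 < ⊤ := by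
  refine (Measure.ae_prod_iff_ae_ae ?_).2 (h.ae_lt_top hM)
  exact measurableSet_lt h.measurable measurable_const

theorem IsENNKernelBound.exists_hasENNKernel {k : X → X → ℝ≥0∞} {M : ℝ≥0∞}
    (h : IsENNKernelBound μ k M) (hM : M ≠ ⊤) : ∃ T : L2Op μ, HasENNKernel T k := by
  obtain ⟨T, hT⟩ := h.exists_operator hM
  exact ⟨T, hT.hasENNKernel_of_toReal h.measurable (h.ae_prod_lt_top hM)⟩

/-- The operator constructed from the kernel agrees with `A` on nonnegative functions. -/
theorem HasENNKernel.hasNonnegKernel {A : L2Op μ} {k : X → X → ℝ≥0∞} (h : HasENNKernel A k) :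
    HasNonnegKernel A fun x y => (k x y).toReal := by
  obtain ⟨T, hT⟩ := h.isENNKernelBound.exists_operator enorm_ne_top
  have hT' := hT.hasENNKernel_of_toReal h.measurable
    (h.isENNKernelBound.ae_prod_lt_top enorm_ne_top)
  suffices A = T by rwa [this]
  refine ext_of_nonneg fun F hF => Lp.ext ?_
  filter_upwards [h.nonneg_and_apply F hF, hT'.nonneg_and_apply F hF] with x hx hx'
  have he : ‖A F x‖ₑ = ‖T F x‖ₑ := hx.2.trans hx'.2.symm
  rw [eq_coe_norm_of_nonneg hx.1, eq_coe_norm_of_nonneg hx'.1, ← toReal_enorm, he, toReal_enorm]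

theorem HasENNKernel.isPositiveKernelOperator {A : L2Op μ} {k : X → X → ℝ≥0∞}
    (h : HasENNKernel A k) : IsPositiveKernelOperator A := ⟨_, h.hasNonnegKernel⟩

theorem IsPositiveKernelOperator.exists_hasENNKernel {A : L2Op μ}
    (h : IsPositiveKernelOperator A) : ∃ k, HasENNKernel A k := by
  obtain ⟨a, ha⟩ := h
  obtain ⟨k, hk, -⟩ := ha.exists_hasENNKernel
  exact ⟨k, hk⟩

theorem HasENNKernel.enorm_apply_le {A : L2Op μ} {k : X → X → ℝ≥0∞} (h : HasENNKernel A k)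
    (f : Lp ℂ 2 μ) : ∀ᵐ x ∂μ, ‖A f x‖ₑ ≤ ∫⁻ y, k x y * ‖f y‖ₑ ∂μ := by
  filter_upwards [h.hasNonnegKernel.apply_eq f] with x hx
  rw [hx]
  exact enorm_integral_kernel_le x f

theorem HasENNKernel.enorm_le {A : L2Op μ} {k : X → X → ℝ≥0∞} (h : HasENNKernel A k)
    {M : ℝ≥0∞} (hM : IsENNKernelBound μ k M) : ‖A‖ₑ ≤ M := by
  rcases eq_or_ne M ⊤ with rfl | hMt
  · exact le_top
  suffices ‖A‖ ≤ M.toReal by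
    rw [← ofReal_norm]
    exact ENNReal.ofReal_le_of_le_toReal this
  refine ContinuousLinearMap.opNorm_le_bound _ ENNReal.toReal_nonneg fun f => ?_
  have h2 : ‖A f‖ₑ ^ 2 ≤ (M * ‖f‖ₑ) ^ 2 := by
    rw [enorm_Lp_sq]
    refine (lintegral_mono_ae ?_).trans (hM.bound f)
    filter_upwards [h.enorm_apply_le f] with x hx
    gcongr
  have h3 : ‖A f‖ₑ ≤ M * ‖f‖ₑ := (ENNReal.pow_le_pow_left_iff two_ne_zero).1 h2
  rw [← toReal_enorm (A f), ← toReal_enorm f, ← ENNReal.toReal_mul]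
  exact ENNReal.toReal_mono (ENNReal.mul_ne_top hMt enorm_ne_top) h3

theorem HasENNKernel.isDominatedBy {A B : L2Op μ} {a b : X → X → ℝ≥0∞} (ha : HasENNKernel A a)
    (hb : HasENNKernel B b) (hab : ∀ x y, a x y ≤ b x y) : IsDominatedBy A B := by
  intro f g hfg
  have hg : ∀ᵐ x ∂μ, 0 ≤ g x := by
    filter_upwards [hfg] with x hx using le_trans (by exact_mod_cast norm_nonneg _) hx
  filter_upwards [ha.enorm_apply_le f, hb.nonneg_and_apply g hg] with x hx hx'
  have : ‖A f x‖ₑ ≤ ‖B g x‖ₑ := by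
    rw [hx'.2]
    refine hx.trans (lintegral_mono_ae ?_)
    filter_upwards [hfg, hg] with y hy hgy
    rw [eq_coe_norm_of_nonneg hgy] at hy
    have : ‖f y‖ₑ ≤ ‖g y‖ₑ := enorm_le_iff_norm_le.2 (by exact_mod_cast hy)
    exact mul_le_mul' (hab x y) this
  rw [eq_coe_norm_of_nonneg hx'.1]
  exact_mod_cast enorm_le_iff_norm_le.1 this

theorem HasENNKernel.mul {A B : L2Op μ} {a b : X → X → ℝ≥0∞} (ha : HasENNKernel A a)
    (hb : HasENNKernel B b) : HasENNKernel (A * B) fun x z => ∫⁻ y, a x y * b y z ∂μ := by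
  refine ⟨?_, fun F hF => ?_⟩
  · refine Measurable.lintegral_prod_right'
      (f := fun p : (X × X) × X => a p.1.1 p.2 * b p.2 p.1.2) ?_
    exact (ha.measurable.comp ((measurable_fst.comp measurable_fst).prodMk measurable_snd)).mul
      (hb.measurable.comp (measurable_snd.prodMk (measurable_snd.comp measurable_fst)))
  · have hB := hb.nonneg_and_apply F hF
    filter_upwards [ha.nonneg_and_apply (B F) (hB.mono fun _ h => h.1)] with x hx
    refine ⟨hx.1, hx.2.trans ?_⟩
    have hFm : Measurable fun z => ‖F z‖ₑ := (Lp.stronglyMeasurable F).measurable.enorm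
    calc ∫⁻ y, a x y * ‖B F y‖ₑ ∂μ = ∫⁻ y, ∫⁻ z, a x y * b y z * ‖F z‖ₑ ∂μ ∂μ := by
          refine lintegral_congr_ae ?_
          filter_upwards [hB] with y hy
          rw [hy.2, ← lintegral_const_mul]
          · simp only [mul_assoc]
          · exact (hb.measurable.comp measurable_prodMk_left).mul hFm
      _ = ∫⁻ z, ∫⁻ y, a x y * b y z * ‖F z‖ₑ ∂μ ∂μ := by
          refine lintegral_lintegral_swap (Measurable.aemeasurable ?_)
          exact ((ha.measurable.comp (measurable_const.prodMk measurable_fst)).mul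
            hb.measurable).mul (hFm.comp measurable_snd)
      _ = ∫⁻ z, (∫⁻ y, a x y * b y z ∂μ) * ‖F z‖ₑ ∂μ := by
          refine lintegral_congr fun z => lintegral_mul_const _ ?_
          exact (ha.measurable.comp measurable_prodMk_left).mul
            (hb.measurable.comp measurable_prodMk_right)

/-- By Tonelli's theorem the integrals of `A* F` and of `x ↦ ∫ k(y, x) F(y) dy` agree over every
set of finite measure. -/
theorem HasENNKernel.adjoint {A : L2Op μ} {k : X → X → ℝ≥0∞} (h : HasENNKernel A k) :
    HasENNKernel (ContinuousLinearMap.adjoint A) fun x y => k y x := by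
  refine ⟨h.measurable.comp measurable_swap, fun F hF => ?_⟩
  have hFm : Measurable fun z => ‖F z‖ₑ := (Lp.stronglyMeasurable F).measurable.enorm
  have hhm : Measurable fun x => ∫⁻ y, k y x * ‖F y‖ₑ ∂μ := by
    refine Measurable.lintegral_prod_right' (f := fun p : X × X => k p.2 p.1 * ‖F p.2‖ₑ) ?_
    exact (h.measurable.comp measurable_swap).mul (hFm.comp measurable_snd)
  have key : ∀ s, MeasurableSet s → μ s < ⊤ →
      ∫⁻ x in s, ∫⁻ y, k y x * ‖F y‖ₑ ∂μ ∂μ ≠ ⊤ ∧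
      ∫ x in s, ContinuousLinearMap.adjoint A F x ∂μ =
        ((∫⁻ x in s, ∫⁻ y, k y x * ‖F y‖ₑ ∂μ ∂μ).toReal : ℂ) := by
    intro s hs hμs
    set G : Lp ℂ 2 μ := indicatorConstLp 2 hs hμs.ne (1 : ℂ) with hG
    have hGs : ∀ᵐ x ∂μ, G x = s.indicator (fun _ => (1 : ℂ)) x := indicatorConstLp_coeFn
    have hG0 : ∀ᵐ x ∂μ, 0 ≤ G x := by
      filter_upwards [hGs] with x hx
      rw [hx]
      by_cases hxs : x ∈ s <;> simp [hxs]
    have hAG := h.nonneg_and_apply G hG0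
    have hT : ∫⁻ y, ‖A G y‖ₑ * ‖F y‖ₑ ∂μ = ∫⁻ x in s, ∫⁻ y, k y x * ‖F y‖ₑ ∂μ ∂μ := by
      calc ∫⁻ y, ‖A G y‖ₑ * ‖F y‖ₑ ∂μ = ∫⁻ y, ∫⁻ x in s, k y x * ‖F y‖ₑ ∂μ ∂μ := by
            refine lintegral_congr_ae ?_
            filter_upwards [hAG] with y hy
            have hky : Measurable fun x => k y x := h.measurable.comp measurable_prodMk_left
            rw [hy.2, lintegral_mul_const _ hky, ← lintegral_indicator hs]
            congr 1
            refine lintegral_congr_ae ?_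
            filter_upwards [hGs] with x hx
            rw [hx]
            by_cases hxs : x ∈ s <;> simp [hxs]
        _ = _ := by
            refine lintegral_lintegral_swap (Measurable.aemeasurable ?_)
            exact h.measurable.mul (hFm.comp measurable_fst)
    have hre : (fun y => inner ℂ (A G y) (F y)) =ᵐ[μ]
        fun y => ((‖A G y‖ * ‖F y‖ : ℝ) : ℂ) := by
      filter_upwards [hAG, hF] with y hy hy'
      rw [RCLike.inner_apply, eq_coe_norm_of_nonneg hy.1, eq_coe_norm_of_nonneg hy']
      simp [mul_comm]
    have hfin : ∫⁻ y, ‖A G y‖ₑ * ‖F y‖ₑ ∂μ < ⊤ := by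
      have hi : Integrable (fun y => inner ℂ (A G y) (F y)) μ := L2.integrable_inner _ _
      have := hi.2
      refine lt_of_eq_of_lt (lintegral_congr_ae ?_) this
      filter_upwards [hre] with y hy
      rw [hy, enorm_complex_ofReal, enorm_mul, enorm_norm, enorm_norm]
    refine ⟨hT ▸ hfin.ne, ?_⟩
    rw [← hT, ← L2.inner_indicatorConstLp_one hs hμs.ne, ContinuousLinearMap.adjoint_inner_right,
      L2.inner_def, integral_congr_ae hre, integral_complex_ofReal,
      integral_eq_lintegral_of_nonneg_ae]
    · congr 2
      refine lintegral_congr fun y => ?_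
      rw [ENNReal.ofReal_mul (norm_nonneg _), ofReal_norm, ofReal_norm]
    · exact Eventually.of_forall fun y => by positivity
    · exact ((Lp.aestronglyMeasurable _).norm).mul (Lp.aestronglyMeasurable _).norm
  have hlt : ∀ᵐ x ∂μ, ∫⁻ y, k y x * ‖F y‖ₑ ∂μ < ⊤ :=
    ae_of_forall_measure_lt_top_ae_restrict _ fun s hs hμs => ae_lt_top hhm (key s hs hμs).1
  have hi : ∀ s, MeasurableSet s → μ s < ⊤ →
      IntegrableOn (fun x => ((∫⁻ y, k y x * ‖F y‖ₑ ∂μ).toReal : ℂ)) s μ := fun s hs hμs =>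
    (integrable_toReal_of_lintegral_ne_top hhm.aemeasurable (key s hs hμs).1).ofReal
  have heq : (fun x => ContinuousLinearMap.adjoint A F x) =ᵐ[μ]
      fun x => ((∫⁻ y, k y x * ‖F y‖ₑ ∂μ).toReal : ℂ) := by
    refine ae_eq_of_forall_setIntegral_eq_of_sigmaFinite (fun s hs hμs => ?_) hi
      fun s hs hμs => ?_
    · exact integrableOn_Lp_of_measure_ne_top _ (by norm_num) hμs.ne
    · rw [(key s hs hμs).2, integral_complex_ofReal,
        integral_toReal hhm.aemeasurable (ae_restrict_of_ae hlt)]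
  filter_upwards [heq, hlt] with x hx hx'
  rw [hx]
  refine ⟨by exact_mod_cast ENNReal.toReal_nonneg, ?_⟩
  rw [enorm_complex_ofReal, ← ofReal_norm, Real.norm_of_nonneg ENNReal.toReal_nonneg,
    ENNReal.ofReal_toReal hx'.ne]

/-! ### Hadamard products of kernels -/

theorem IsHadamardPowerProduct.exists_hasENNKernel {m : ℕ} {α : ℝ} (hα : 0 < α)
    {A : Fin m → L2Op μ} {C : L2Op μ} (h : IsHadamardPowerProduct α A C) :
    ∃ k : Fin m → X → X → ℝ≥0∞, (∀ j, HasENNKernel (A j) (k j)) ∧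
      HasENNKernel C fun x y => ∏ j, k j x y ^ α := by
  obtain ⟨a, ha, hC⟩ := h
  choose k hk hfin hka using fun j => (ha j).exists_hasENNKernel
  refine ⟨k, hk, HasNonnegKernel.hasENNKernel_of_toReal (hC.congr ?_) ?_ ?_⟩
  · filter_upwards [ae_all_iff.2 hka] with p hp
    rw [ENNReal.toReal_prod]
    refine Finset.prod_congr rfl fun j _ => ?_
    rw [← ENNReal.toReal_rpow, hp j]
  · exact Finset.measurable_fun_prod _ fun j _ => (hk j).measurable.pow_const α
  · exact Eventually.of_forall fun p =>
      (ENNReal.prod_ne_top fun j _ => ENNReal.rpow_ne_top_of_nonneg hα.le (hfin j _ _)).lt_top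

theorem HasENNKernel.isHadamardPowerProduct {m : ℕ} {α : ℝ} {A : Fin m → L2Op μ} {C : L2Op μ}
    {k : Fin m → X → X → ℝ≥0∞} (hk : ∀ j, HasENNKernel (A j) (k j))
    (hC : HasENNKernel C fun x y => ∏ j, k j x y ^ α) : IsHadamardPowerProduct α A C := by
  refine ⟨fun j x y => (k j x y).toReal, fun j => (hk j).hasNonnegKernel, ?_⟩
  have := hC.hasNonnegKernel
  simpa only [ENNReal.toReal_prod, ENNReal.toReal_rpow] using this

end NonnegKernels

/-! ### Hadamard powers and admissible exponents -/

section Hadamard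

variable {X : Type*} [MeasurableSpace X] {μ : Measure X} {m : ℕ} {α : ℝ}

/-- The two properties of an exponent `α` for which Hadamard products `A₁^(α) ∘ ⋯ ∘ A_m^(α)` are
studied: a Hölder inequality for `m` functions and the estimate of the operator norm which it
suggests. They hold for `α = 1 / m`, and for the counting measure if `α ≥ 1 / m`. -/
structure IsHadamardExponent (μ : Measure X) (m : ℕ) (α : ℝ) : Prop where
  pos : 0 < α
  lintegral_le : ∀ f : Fin m → X → ℝ≥0∞, (∀ j, Measurable (f j)) →
    ∫⁻ x, ∏ j, f j x ^ α ∂μ ≤ ∏ j, (∫⁻ x, f j x ∂μ) ^ α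
  bound : ∀ (A : Fin m → L2Op μ) (k : Fin m → X → X → ℝ≥0∞), (∀ j, HasENNKernel (A j) (k j)) →
    IsENNKernelBound μ (fun x y => ∏ j, k j x y ^ α) (∏ j, ‖A j‖ₑ ^ α)

theorem IsHadamardPowerProduct.perm {A : Fin m → L2Op μ} {C : L2Op μ}
    (h : IsHadamardPowerProduct α A C) (σ : Equiv.Perm (Fin m)) :
    IsHadamardPowerProduct α (fun j => A (σ j)) C := by
  obtain ⟨a, ha, hC⟩ := h
  refine ⟨fun j => a (σ j), fun j => ha (σ j), ?_⟩
  have hσ : ∀ x y, ∏ j, a (σ j) x y ^ α = ∏ j, a j x y ^ α := fun x y =>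
    Equiv.prod_comp σ fun j => a j x y ^ α
  simpa only [hσ] using hC

theorem IsHadamardExponent.prod_enorm_ne_top (hα : IsHadamardExponent μ m α)
    (A : Fin m → L2Op μ) : ∏ j, ‖A j‖ₑ ^ α ≠ ⊤ :=
  ENNReal.prod_ne_top fun _ _ => ENNReal.rpow_ne_top_of_nonneg hα.pos.le enorm_ne_top

theorem enorm_adjoint (A : L2Op μ) : ‖ContinuousLinearMap.adjoint A‖ₑ = ‖A‖ₑ := by
  rw [← ofReal_norm, ← ofReal_norm, LinearIsometryEquiv.norm_map]

theorem IsBoundedPositiveKernelSet.setNorm_ne_top {S : Set (L2Op μ)}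
    (h : IsBoundedPositiveKernelSet S) : setNorm S ≠ ⊤ :=
  isBounded_iff_setNorm_ne_top.1 h.bounded

/-! ### The combinatorics of the families `Σ` and `Ω` -/

theorem omegaFamily_eq_drop_mul_take (ν : Equiv.Perm (Fin m)) (S : Fin m → Set (L2Op μ))
    (i : Fin m) : omegaFamily ν S i =
      ((List.ofFn fun k => S (ν k)).drop i).prod * ((List.ofFn fun k => S (ν k)).take i).prod := by
  rw [omegaFamily, List.rotate_eq_drop_append_take (by simp [i.isLt.le]), List.prod_append]

theorem orderedProduct_eq_take_mul_drop (ν : Equiv.Perm (Fin m)) (S : Fin m → Set (L2Op μ))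
    (i : ℕ) : orderedProduct ν S =
      ((List.ofFn fun k => S (ν k)).take i).prod * ((List.ofFn fun k => S (ν k)).drop i).prod := by
  rw [← List.prod_append, List.take_append_drop, orderedProduct]

theorem jointSpectralRadius_omegaFamily_le (ν : Equiv.Perm (Fin m))
    {S : Fin m → Set (L2Op μ)} (hS : ∀ j, setNorm (S j) ≠ ⊤) (i : Fin m) :
    jointSpectralRadius (omegaFamily ν S i) ≤ jointSpectralRadius (orderedProduct ν S) := by
  have hl : ∀ T ∈ List.ofFn fun k => S (ν k), setNorm T ≠ ⊤ := fun T hT => by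
    obtain ⟨k, rfl⟩ := List.mem_ofFn.1 hT
    exact hS _
  rw [omegaFamily_eq_drop_mul_take, orderedProduct_eq_take_mul_drop ν S i]
  exact jointSpectralRadius_mul_comm_le
    (setNorm_list_prod_ne_top fun T hT => hl T (List.mem_of_mem_drop hT))
    (setNorm_list_prod_ne_top fun T hT => hl T (List.mem_of_mem_take hT))

/-- As `i` runs through all indices, so do the indices of the left and of the right factor of
`Σᵢ`. -/
theorem exists_perm_sigmaFamily (hm : Even m) (τ : Equiv.Perm (Fin m))
    (Ψ : Fin m → Set (L2Op μ)) : ∃ σ σ' : Equiv.Perm (Fin m),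
      ∀ i, sigmaFamily hm τ Ψ i = adjointSet (Ψ (σ i)) * Ψ (σ' i) := by
  obtain ⟨k, rfl⟩ := hm
  let p : Fin (k + k) → Fin (k + k) := fun i =>
    if h : (i : ℕ) < (k + k) / 2 then ⟨2 * i, by omega⟩
    else ⟨2 * (i - (k + k) / 2) + 1, by omega⟩
  let q : Fin (k + k) → Fin (k + k) := fun i =>
    if h : (i : ℕ) < (k + k) / 2 then ⟨2 * i + 1, by omega⟩
    else ⟨2 * (i - (k + k) / 2), by omega⟩
  have hp : Function.Injective p := fun i j hij => by
    simp only [p] at hij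
    apply Fin.ext
    split_ifs at hij <;> rw [Fin.mk.injEq] at hij <;> omega
  have hq : Function.Injective q := fun i j hij => by
    simp only [q] at hij
    apply Fin.ext
    split_ifs at hij <;> rw [Fin.mk.injEq] at hij <;> omega
  refine ⟨(Equiv.ofBijective p (Finite.injective_iff_bijective.1 hp)).trans τ,
    (Equiv.ofBijective q (Finite.injective_iff_bijective.1 hq)).trans τ, fun i => ?_⟩
  simp only [sigmaFamily, Equiv.trans_apply, Equiv.ofBijective_apply, p, q]
  split_ifs <;> rfl

/-! ### Hadamard products of operators -/

variable [SigmaFinite μ]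

theorem IsHadamardExponent.exists_product (hα : IsHadamardExponent μ m α) {A : Fin m → L2Op μ}
    (hA : ∀ j, IsPositiveKernelOperator (A j)) : ∃ C, IsHadamardPowerProduct α A C := by
  choose k hk using fun j => (hA j).exists_hasENNKernel
  obtain ⟨C, hC⟩ := (hα.bound A k hk).exists_hasENNKernel (hα.prod_enorm_ne_top A)
  exact ⟨C, hC.isHadamardPowerProduct hk⟩

theorem IsHadamardPowerProduct.enorm_le (hα : IsHadamardExponent μ m α) {A : Fin m → L2Op μ}
    {C : L2Op μ} (h : IsHadamardPowerProduct α A C) : ‖C‖ₑ ≤ ∏ j, ‖A j‖ₑ ^ α := by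
  obtain ⟨k, hk, hC⟩ := h.exists_hasENNKernel hα.pos
  exact hC.enorm_le (hα.bound A k hk)

theorem IsHadamardPowerProduct.adjoint (hα : IsHadamardExponent μ m α) {A : Fin m → L2Op μ}
    {C : L2Op μ} (h : IsHadamardPowerProduct α A C) :
    IsHadamardPowerProduct α (fun j => ContinuousLinearMap.adjoint (A j))
      (ContinuousLinearMap.adjoint C) := by
  obtain ⟨k, hk, hC⟩ := h.exists_hasENNKernel hα.pos
  exact hC.adjoint.isHadamardPowerProduct fun j => (hk j).adjoint

/-- Hölder's inequality in the integral over the intermediate variable: the product of two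
Hadamard products is dominated by the Hadamard product of the products. -/
theorem IsHadamardPowerProduct.mul (hα : IsHadamardExponent μ m α) {A B : Fin m → L2Op μ}
    {C D : L2Op μ} (hC : IsHadamardPowerProduct α A C) (hD : IsHadamardPowerProduct α B D) :
    ∃ E, IsHadamardPowerProduct α (fun j => A j * B j) E ∧ IsDominatedBy (C * D) E := by
  obtain ⟨a, ha, hC⟩ := hC.exists_hasENNKernel hα.pos
  obtain ⟨b, hb, hD⟩ := hD.exists_hasENNKernel hα.pos
  obtain ⟨E, hE⟩ := (hα.bound _ _ fun j => (ha j).mul (hb j)).exists_hasENNKernel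
    (hα.prod_enorm_ne_top _)
  refine ⟨E, hE.isHadamardPowerProduct fun j => (ha j).mul (hb j),
    (hC.mul hD).isDominatedBy hE fun x z => ?_⟩
  refine le_trans (le_of_eq ?_) (hα.lintegral_le (fun j y => a j x y * b j y z) fun j => ?_)
  · refine lintegral_congr fun y => ?_
    rw [← Finset.prod_mul_distrib]
    exact Finset.prod_congr rfl fun j _ => (ENNReal.mul_rpow_of_nonneg _ _ hα.pos.le).symm
  · exact ((ha j).measurable.comp measurable_prodMk_left).mul
      ((hb j).measurable.comp measurable_prodMk_right)

theorem IsHadamardPowerProduct.isDominatedBy_self {A : Fin m → L2Op μ} {C : L2Op μ}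
    (hα : IsHadamardExponent μ m α) (h : IsHadamardPowerProduct α A C) : IsDominatedBy C C := by
  obtain ⟨k, -, hC⟩ := h.exists_hasENNKernel hα.pos
  exact hC.isDominatedBy hC fun _ _ => le_rfl

theorem IsHadamardPowerProduct.list_prod (hα : IsHadamardExponent μ m α) {n : ℕ}
    {C : Fin (n + 1) → L2Op μ} {A : Fin (n + 1) → Fin m → L2Op μ}
    (h : ∀ k, IsHadamardPowerProduct α (A k) (C k)) :
    ∃ E, IsHadamardPowerProduct α (fun j => (List.ofFn fun k => A k j).prod) E ∧
      IsDominatedBy (List.ofFn C).prod E := by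
  induction n with
  | zero => exact ⟨C 0, by simpa using h 0, by simpa using (h 0).isDominatedBy_self hα⟩
  | succ n ih =>
    obtain ⟨E', hE', hd'⟩ := ih fun k => h k.succ
    obtain ⟨E, hE, hd⟩ := (h 0).mul hα hE'
    refine ⟨E, ?_, ?_⟩
    · simpa only [List.ofFn_succ (n := n + 1), List.prod_cons] using hE
    · rw [List.ofFn_succ, List.prod_cons]
      exact (((h 0).isDominatedBy_self hα).mul hd').trans hd

theorem exists_hadamard_of_mem_hadamardSet_pow (hα : IsHadamardExponent μ m α)
    {T : Fin m → Set (L2Op μ)} {n : ℕ} (hn : 0 < n) {C : L2Op μ}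
    (hC : C ∈ hadamardSet α T ^ n) :
    ∃ (V : Fin m → L2Op μ) (E : L2Op μ), (∀ j, V j ∈ T j ^ n) ∧
      IsHadamardPowerProduct α V E ∧ IsDominatedBy C E := by
  obtain ⟨n, rfl⟩ : ∃ k, n = k + 1 := ⟨n - 1, by omega⟩
  obtain ⟨f, rfl⟩ := Set.mem_pow.1 hC
  choose A hA hf using fun k => (f k).2
  obtain ⟨E, hE, hd⟩ := IsHadamardPowerProduct.list_prod hα hf
  exact ⟨_, E, fun j => Set.mem_pow.2 ⟨fun k => ⟨A k j, hA k j⟩, rfl⟩, hE, hd⟩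

/-! ### Bounded sets of positive kernel operators -/

theorem IsBoundedPositiveKernelSet.adjointSet {S : Set (L2Op μ)}
    (h : IsBoundedPositiveKernelSet S) : IsBoundedPositiveKernelSet (adjointSet S) := by
  refine ⟨isBounded_iff_setNorm_ne_top.2 (ne_top_of_le_ne_top h.setNorm_ne_top
    (setNorm_le ?_)), ?_⟩
  · rintro _ ⟨A, hA, rfl⟩
    exact (enorm_adjoint A).trans_le (enorm_le_setNorm hA)
  · rintro _ ⟨A, hA, rfl⟩
    obtain ⟨k, hk⟩ := (h.kernel A hA).exists_hasENNKernel
    exact hk.adjoint.isPositiveKernelOperator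

theorem IsBoundedPositiveKernelSet.mul {S T : Set (L2Op μ)}
    (hS : IsBoundedPositiveKernelSet S) (hT : IsBoundedPositiveKernelSet T) :
    IsBoundedPositiveKernelSet (S * T) := by
  refine ⟨isBounded_iff_setNorm_ne_top.2 (ne_top_of_le_ne_top
    (ENNReal.mul_ne_top hS.setNorm_ne_top hT.setNorm_ne_top) (setNorm_mul_le _ _)), ?_⟩
  rintro _ ⟨A, hA, B, hB, rfl⟩
  obtain ⟨a, ha⟩ := (hS.kernel A hA).exists_hasENNKernel
  obtain ⟨b, hb⟩ := (hT.kernel B hB).exists_hasENNKernel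
  exact (ha.mul hb).isPositiveKernelOperator

theorem IsBoundedPositiveKernelSet.list_prod {l : List (Set (L2Op μ))} (hl : l ≠ [])
    (h : ∀ S ∈ l, IsBoundedPositiveKernelSet S) : IsBoundedPositiveKernelSet l.prod := by
  induction l with
  | nil => exact absurd rfl hl
  | cons S l ih =>
    rcases eq_or_ne l [] with rfl | hl'
    · simpa using h S (by simp)
    · rw [List.prod_cons]
      exact (h S (by simp)).mul (ih hl' fun T hT => h T (by simp [hT]))

theorem IsHadamardExponent.hadamardSetDefined (hα : IsHadamardExponent μ m α)
    {T : Fin m → Set (L2Op μ)} (hT : ∀ j, IsBoundedPositiveKernelSet (T j)) :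
    HadamardSetDefined α T := by
  refine ⟨fun A hA => hα.exists_product fun j => (hT j).kernel _ (hA j), ?_, ?_⟩
  · refine isBounded_iff_setNorm_ne_top.2 (ne_top_of_le_ne_top
      (ENNReal.prod_ne_top (s := Finset.univ) (f := fun j => setNorm (T j) ^ α) fun j _ =>
        ENNReal.rpow_ne_top_of_nonneg hα.pos.le (hT j).setNorm_ne_top) (setNorm_le ?_))
    rintro C ⟨A, hA, hC⟩
    refine (hC.enorm_le hα).trans (Finset.prod_le_prod' fun j _ => ?_)
    exact ENNReal.rpow_le_rpow (enorm_le_setNorm (hA j)) hα.pos.le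
  · rintro C ⟨A, hA, hC⟩
    exact ⟨_, hC.choose_spec.2⟩

/-! ### Spectral radii of Hadamard products -/

theorem jointSpectralRadius_hadamardSet_le (hm : 0 < m) (hα : IsHadamardExponent μ m α)
    {T : Fin m → Set (L2Op μ)} (hT : ∀ j, setNorm (T j) ≠ ⊤) {c : ℝ≥0∞}
    (hc : ∀ j, jointSpectralRadius (T j) ≤ c) :
    jointSpectralRadius (hadamardSet α T) ≤ c ^ ((m : ℝ) * α) := by
  have hmα : 0 < (m : ℝ) * α := mul_pos (by exact_mod_cast hm) hα.pos
  rw [← ENNReal.rpow_inv_le_iff hmα]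
  refine le_of_forall_gt_imp_ge_of_dense fun b hb => ?_
  rcases eq_or_ne b ⊤ with rfl | hbt
  · exact le_top
  rw [ENNReal.rpow_inv_le_iff hmα]
  choose M hM hMb using fun j =>
    exists_bound_of_jointSpectralRadius_lt (hT j) ((hc j).trans_lt hb) hbt
  refine jointSpectralRadius_le_of_bound (M := ∏ j, M j ^ α)
    (ENNReal.prod_ne_top fun j _ => ENNReal.rpow_ne_top_of_nonneg hα.pos.le (hM j))
    fun n hn => setNorm_le fun C hC => ?_
  obtain ⟨V, E, hV, hE, hd⟩ := exists_hadamard_of_mem_hadamardSet_pow hα hn hC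
  calc ‖C‖ₑ ≤ ‖E‖ₑ := hd.enorm_le
    _ ≤ ∏ j, ‖V j‖ₑ ^ α := hE.enorm_le hα
    _ ≤ ∏ j, (M j * b ^ n) ^ α := Finset.prod_le_prod' fun j _ =>
        ENNReal.rpow_le_rpow ((enorm_le_setNorm (hV j)).trans (hMb j n)) hα.pos.le
    _ = (∏ j, M j ^ α) * (b ^ ((m : ℝ) * α)) ^ n := by
        simp only [ENNReal.mul_rpow_of_nonneg _ _ hα.pos.le, Finset.prod_mul_distrib,
          Finset.prod_const, Finset.card_univ, Fintype.card_fin]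
        congr 1
        simp only [← ENNReal.rpow_natCast, ← ENNReal.rpow_mul]
        congr 1
        ring

theorem IsHadamardPowerProduct.spectralRadius_le (hm : 0 < m) (hα : IsHadamardExponent μ m α)
    {V : Fin m → L2Op μ} {E : L2Op μ} (h : IsHadamardPowerProduct α V E) {c : ℝ≥0∞}
    (hc : ∀ j, spectralRadius ℂ (V j) ≤ c) : spectralRadius ℂ E ≤ c ^ ((m : ℝ) * α) := by
  rw [← jointSpectralRadius_singleton]
  refine le_trans (jointSpectralRadius_mono_of_setNorm fun n _ => setNorm_mono ?_)
    (jointSpectralRadius_hadamardSet_le hm hα (T := fun j => {V j})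
      (fun j => setNorm_singleton_ne_top _)
      fun j => (jointSpectralRadius_singleton (V j)).trans_le (hc j))
  refine Set.pow_subset_pow_left (Set.singleton_subset_iff.2 ⟨V, fun j => rfl, h⟩)

theorem generalizedSpectralRadius_hadamardSet_le (hm : 0 < m) (hα : IsHadamardExponent μ m α)
    {T : Fin m → Set (L2Op μ)} {c : ℝ≥0∞}
    (hc : ∀ j n, 0 < n → ∀ A ∈ T j ^ n, spectralRadius ℂ A ≤ c ^ n) :
    generalizedSpectralRadius (hadamardSet α T) ≤ c ^ ((m : ℝ) * α) := by
  refine generalizedSpectralRadius_le_of_bound fun n hn C hC => ?_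
  obtain ⟨V, E, hV, hE, hd⟩ := exists_hadamard_of_mem_hadamardSet_pow hα hn hC
  refine (hd.spectralRadius_le.trans
    (hE.spectralRadius_le hm hα fun j => hc j n hn _ (hV j))).trans (le_of_eq ?_)
  simp only [← ENNReal.rpow_natCast, ← ENNReal.rpow_mul]
  congr 1
  ring

/-! ### Hadamard products of the families `Σ` and `Ω` -/

theorem isBoundedPositiveKernelSet_omegaFamily (ν : Equiv.Perm (Fin m))
    {S : Fin m → Set (L2Op μ)} (hS : ∀ j, IsBoundedPositiveKernelSet (S j)) (i : Fin m) :
    IsBoundedPositiveKernelSet (omegaFamily ν S i) := by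
  refine IsBoundedPositiveKernelSet.list_prod ?_ fun T hT => ?_
  · have : m ≠ 0 := i.pos.ne'
    rw [Ne, List.rotate_eq_nil_iff, List.ofFn_eq_nil_iff]
    exact this
  · rw [List.mem_rotate, List.mem_ofFn] at hT
    obtain ⟨k, rfl⟩ := hT
    exact hS _

/-- Each product of `m` elements `∘ᵢ Bₖᵢ^(α)`, `1 ≤ k ≤ m`, is rearranged so that the `k`-th
factor contributes an element of `Σ_{ν(i + k)}` in the position `i`, with `i + k` taken
modulo `m`. -/
theorem hadamardSet_pow_isSetDominatedBy (hm : 0 < m) (hα : IsHadamardExponent μ m α)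
    (ν : Equiv.Perm (Fin m)) (S : Fin m → Set (L2Op μ)) :
    IsSetDominatedBy (hadamardSet α S ^ m) (hadamardSet α (omegaFamily ν S)) := by
  obtain ⟨n, rfl⟩ : ∃ n, m = n + 1 := ⟨m - 1, by omega⟩
  intro C hC
  obtain ⟨f, rfl⟩ := Set.mem_pow.1 hC
  choose A hA hf using fun k => (f k).2
  obtain ⟨E, hE, hd⟩ := IsHadamardPowerProduct.list_prod hα
    fun k => (hf k).perm ((Equiv.addRight k).trans ν)
  refine ⟨E, ⟨_, fun i => ?_, hE⟩, hd⟩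
  have hrot : (List.ofFn fun k => S (ν k)).rotate i = List.ofFn fun k => S (ν (i + k)) := by
    refine List.ext_getElem (by simp) fun k h₁ h₂ => ?_
    simp only [List.getElem_rotate, List.getElem_ofFn, List.length_ofFn]
    congr 2
    apply Fin.ext
    simp [Fin.val_add, add_comm]
  rw [omegaFamily, hrot]
  exact Set.mem_prod_list_ofFn.2 ⟨fun k => ⟨A k (ν (i + k)), hA k _⟩, rfl⟩

theorem isBoundedPositiveKernelSet_sigmaFamily (hm : Even m) (τ : Equiv.Perm (Fin m))
    {Ψ : Fin m → Set (L2Op μ)} (hΨ : ∀ j, IsBoundedPositiveKernelSet (Ψ j)) (i : Fin m) :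
    IsBoundedPositiveKernelSet (sigmaFamily hm τ Ψ i) := by
  unfold sigmaFamily
  split_ifs
  · exact (hΨ _).adjointSet.mul (hΨ _)
  · exact (hΨ _).adjointSet.mul (hΨ _)

/-- For `C = ∘ⱼ Aⱼ^(α)` the operator `C* C` is dominated by an element of `∘ⱼ Σⱼ^(α)`, and its
spectral radius is `‖C‖²`. -/
theorem setNorm_hadamardSet_sq_le (hα : IsHadamardExponent μ m α) (hm : Even m)
    (τ : Equiv.Perm (Fin m)) (Ψ : Fin m → Set (L2Op μ)) :
    setNorm (hadamardSet α Ψ) ^ (2 : ℝ) ≤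
      generalizedSpectralRadius (hadamardSet α (sigmaFamily hm τ Ψ)) := by
  rw [← ENNReal.le_rpow_inv_iff two_pos]
  refine setNorm_le fun C hC => ?_
  rw [ENNReal.le_rpow_inv_iff two_pos]
  obtain ⟨A, hA, hC⟩ := hC
  obtain ⟨σ, σ', hσ⟩ := exists_perm_sigmaFamily hm τ Ψ
  obtain ⟨D, hD, hd⟩ := ((hC.adjoint hα).perm σ).mul hα (hC.perm σ')
  have hmem : D ∈ hadamardSet α (sigmaFamily hm τ Ψ) := by
    refine ⟨_, fun i => ?_, hD⟩
    rw [hσ]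
    exact Set.mul_mem_mul ⟨_, hA _, rfl⟩ (hA _)
  have hρ : ‖C‖ₑ ^ (2 : ℝ) = spectralRadius ℂ (ContinuousLinearMap.adjoint C * C) := by
    rw [← ContinuousLinearMap.star_eq_adjoint,
      (IsSelfAdjoint.star_mul_self C).spectralRadius_eq_nnnorm, CStarRing.nnnorm_star_mul_self,
      ENNReal.coe_mul, ENNReal.rpow_two, sq]
    rfl
  rw [hρ]
  refine hd.spectralRadius_le.trans ?_
  simpa using spectralRadius_le_generalizedSpectralRadius_pow (n := 1) one_pos
    (by rwa [pow_one])

/-- The chain of inequalities, for the generalized and for the joint spectral radius. -/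
theorem hadamard_spectral_inequalities (hm_pos : 0 < m) (hα : IsHadamardExponent μ m α)
    (hm : Even m) (τ ν : Equiv.Perm (Fin m)) {Ψ : Fin m → Set (L2Op μ)}
    (hΨ : ∀ j, IsBoundedPositiveKernelSet (Ψ j)) {r : Set (L2Op μ) → ℝ≥0∞}
    (hr : r ∈ ({generalizedSpectralRadius, jointSpectralRadius} :
      Set (Set (L2Op μ) → ℝ≥0∞))) :
    setNorm (hadamardSet α Ψ) ≤ r (hadamardSet α (sigmaFamily hm τ Ψ)) ^ (1 / 2 : ℝ) ∧
    r (hadamardSet α (sigmaFamily hm τ Ψ)) ^ (1 / 2 : ℝ) ≤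
      r (hadamardSet α (omegaFamily ν (sigmaFamily hm τ Ψ))) ^ (1 / (2 * (m : ℝ))) ∧
    r (hadamardSet α (omegaFamily ν (sigmaFamily hm τ Ψ))) ^ (1 / (2 * (m : ℝ))) ≤
      r (orderedProduct ν (sigmaFamily hm τ Ψ)) ^ (α / 2) := by
  set S := sigmaFamily hm τ Ψ with hSdef
  have hS : ∀ j, IsBoundedPositiveKernelSet (S j) := isBoundedPositiveKernelSet_sigmaFamily hm τ hΨ
  have hm' : (0 : ℝ) < m := by exact_mod_cast hm_pos
  have h1 : setNorm (hadamardSet α Ψ) ^ (2 : ℝ) ≤ r (hadamardSet α S) := by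
    have h := setNorm_hadamardSet_sq_le hα hm τ Ψ
    rcases hr with rfl | rfl
    · exact h
    · exact h.trans (generalizedSpectralRadius_le_jointSpectralRadius _)
  have h2 : r (hadamardSet α S) ^ m ≤ r (hadamardSet α (omegaFamily ν S)) := by
    have h := hadamardSet_pow_isSetDominatedBy hm_pos hα ν S
    rcases hr with rfl | rfl
    · exact (generalizedSpectralRadius_pow_le _ hm_pos).trans h.generalizedSpectralRadius_le
    · exact (jointSpectralRadius_pow_le (hα.hadamardSetDefined hS).boundedSet.setNorm_ne_top
        hm_pos).trans h.jointSpectralRadius_le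
  have h3 : r (hadamardSet α (omegaFamily ν S)) ≤ r (orderedProduct ν S) ^ ((m : ℝ) * α) := by
    rcases hr with rfl | rfl
    · refine generalizedSpectralRadius_hadamardSet_le hm_pos hα fun i n hn A hA => ?_
      rw [omegaFamily_eq_drop_mul_take] at hA
      obtain ⟨C, hC, hAC⟩ := exists_mem_mul_comm_pow hn hA
      rw [← orderedProduct_eq_take_mul_drop ν S i] at hC
      exact hAC.trans (spectralRadius_le_generalizedSpectralRadius_pow hn hC)
    · exact jointSpectralRadius_hadamardSet_le hm_pos hα
        (fun i => (isBoundedPositiveKernelSet_omegaFamily ν hS i).setNorm_ne_top)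
        (jointSpectralRadius_omegaFamily_le ν fun j => (hS j).setNorm_ne_top)
  refine ⟨?_, ?_, ?_⟩
  · rw [one_div, ENNReal.le_rpow_inv_iff two_pos]
    exact h1
  · calc r (hadamardSet α S) ^ (1 / 2 : ℝ)
        = (r (hadamardSet α S) ^ m) ^ (1 / (2 * (m : ℝ))) := by
          rw [← ENNReal.rpow_natCast, ← ENNReal.rpow_mul]
          congr 1
          field_simp
      _ ≤ _ := ENNReal.rpow_le_rpow h2 (by positivity)
  · refine (ENNReal.rpow_le_rpow h3 (by positivity)).trans (le_of_eq ?_)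
    rw [← ENNReal.rpow_mul]
    congr 1
    field_simp

end Hadamard

/-! ### The exponents `1 / m` and, for sequences, `α ≥ 1 / m` are admissible -/

section Exponents

variable {X : Type*} [MeasurableSpace X] {μ : Measure X} {m : ℕ}

theorem sum_const_one_div (hm : 0 < m) : ∑ _j : Fin m, 1 / (m : ℝ) = 1 := by
  have : (m : ℝ) ≠ 0 := by exact_mod_cast hm.ne'
  simp [this]

theorem lintegral_prod_rpow_one_div_le (hm : 0 < m) (f : Fin m → X → ℝ≥0∞)
    (hf : ∀ j, AEMeasurable (f j) μ) :
    ∫⁻ x, ∏ j, f j x ^ (1 / (m : ℝ)) ∂μ ≤ ∏ j, (∫⁻ x, f j x ∂μ) ^ (1 / (m : ℝ)) :=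
  ENNReal.lintegral_prod_norm_pow_le Finset.univ (fun j _ => hf j) (sum_const_one_div hm)
    fun _ _ => by positivity

theorem prod_const_rpow_one_div (hm : 0 < m) (c : ℝ≥0∞) :
    ∏ _j : Fin m, c ^ (1 / (m : ℝ)) = c := by
  have : (m : ℝ) ≠ 0 := by exact_mod_cast hm.ne'
  rw [Finset.prod_const, Finset.card_univ, Fintype.card_fin, ← ENNReal.rpow_natCast,
    ← ENNReal.rpow_mul, one_div_mul_cancel this, ENNReal.rpow_one]

variable [SigmaFinite μ]

/-- Hölder's inequality, first in the inner and then in the outer integral. -/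
theorem isENNKernelBound_one_div (hm : 0 < m) (A : Fin m → L2Op μ)
    (k : Fin m → X → X → ℝ≥0∞) (hk : ∀ j, HasENNKernel (A j) (k j)) :
    IsENNKernelBound μ (fun x y => ∏ j, k j x y ^ (1 / (m : ℝ)))
      (∏ j, ‖A j‖ₑ ^ (1 / (m : ℝ))) := by
  have hm0 : (0 : ℝ) ≤ 1 / (m : ℝ) := by positivity
  refine ⟨Finset.measurable_fun_prod _ fun j _ => (hk j).measurable.pow_const _, fun F => ?_⟩
  have hFm : Measurable fun z => ‖F z‖ₑ := (Lp.stronglyMeasurable F).measurable.enorm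
  have hin : ∀ x, ∫⁻ y, (∏ j, k j x y ^ (1 / (m : ℝ))) * ‖F y‖ₑ ∂μ ≤
      ∏ j, (∫⁻ y, k j x y * ‖F y‖ₑ ∂μ) ^ (1 / (m : ℝ)) := fun x => by
    refine le_trans (le_of_eq ?_) (lintegral_prod_rpow_one_div_le hm
      (fun j y => k j x y * ‖F y‖ₑ) fun j =>
        (((hk j).measurable.comp measurable_prodMk_left).mul hFm).aemeasurable)
    refine lintegral_congr fun y => ?_
    simp only [ENNReal.mul_rpow_of_nonneg _ _ hm0, Finset.prod_mul_distrib,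
      prod_const_rpow_one_div hm]
  have hpow : ∀ g : Fin m → ℝ≥0∞, (∏ j, g j ^ (1 / (m : ℝ))) ^ 2 =
      ∏ j, (g j ^ 2) ^ (1 / (m : ℝ)) := fun g => by
    rw [← Finset.prod_pow]
    refine Finset.prod_congr rfl fun j _ => ?_
    simp only [← ENNReal.rpow_natCast, ← ENNReal.rpow_mul]
    rw [mul_comm]
  calc ∫⁻ x, (∫⁻ y, (∏ j, k j x y ^ (1 / (m : ℝ))) * ‖F y‖ₑ ∂μ) ^ 2 ∂μ
      ≤ ∫⁻ x, ∏ j, ((∫⁻ y, k j x y * ‖F y‖ₑ ∂μ) ^ 2) ^ (1 / (m : ℝ)) ∂μ := by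
        refine lintegral_mono fun x => ?_
        rw [← hpow]
        gcongr
        exact hin x
    _ ≤ ∏ j, (∫⁻ x, (∫⁻ y, k j x y * ‖F y‖ₑ ∂μ) ^ 2 ∂μ) ^ (1 / (m : ℝ)) :=
        lintegral_prod_rpow_one_div_le hm _ fun j =>
          ((measurable_lintegral_kernel (hk j).measurable F).pow_const 2).aemeasurable
    _ ≤ ∏ j, ((‖A j‖ₑ * ‖F‖ₑ) ^ 2) ^ (1 / (m : ℝ)) := Finset.prod_le_prod' fun j _ =>
        ENNReal.rpow_le_rpow ((hk j).isENNKernelBound.bound F) hm0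
    _ = ((∏ j, ‖A j‖ₑ ^ (1 / (m : ℝ))) * ‖F‖ₑ) ^ 2 := by
        rw [← hpow]
        simp only [ENNReal.mul_rpow_of_nonneg _ _ hm0, Finset.prod_mul_distrib,
          prod_const_rpow_one_div hm]

theorem isHadamardExponent_one_div (hm : 0 < m) : IsHadamardExponent μ m (1 / (m : ℝ)) where
  pos := by positivity
  lintegral_le f hf := lintegral_prod_rpow_one_div_le hm f fun j => (hf j).aemeasurable
  bound := isENNKernelBound_one_div hm

end Exponents

section Counting

variable {R : Type*} [Countable R] [MeasurableSpace R] [DiscreteMeasurableSpace R]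

/-- For sums in place of integrals, `∑ uᵗ ≤ (∑ u)ᵗ` whenever `t ≥ 1`. -/
theorem lintegral_count_rpow_le {t : ℝ} (ht : 1 ≤ t) (u : R → ℝ≥0∞) :
    ∫⁻ x, u x ^ t ∂Measure.count ≤ (∫⁻ x, u x ∂Measure.count) ^ t := by
  have hsplit : ∀ c : ℝ≥0∞, c ^ t = c ^ (t - 1) * c := fun c => by
    conv_rhs => rw [← ENNReal.rpow_one c, ← ENNReal.rpow_mul, one_mul,
      ← ENNReal.rpow_add_of_nonneg _ _ (by linarith) zero_le_one, sub_add_cancel]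
  calc ∫⁻ x, u x ^ t ∂Measure.count
      ≤ ∫⁻ x, (∫⁻ x, u x ∂Measure.count) ^ (t - 1) * u x ∂Measure.count := by
        refine lintegral_mono fun x => ?_
        rw [hsplit]
        refine mul_le_mul' (ENNReal.rpow_le_rpow ?_ (by linarith)) le_rfl
        rw [lintegral_count]
        exact ENNReal.le_tsum x
    _ = _ := by rw [lintegral_const_mul _ (measurable_of_countable u), ← hsplit]

/-- The entries of a nonnegative matrix are bounded by its norm: test it on a basis vector. -/
theorem HasENNKernel.le_enorm_count {A : L2Op (Measure.count : Measure R)} {k : R → R → ℝ≥0∞}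
    (h : HasENNKernel A k) (x y : R) : k x y ≤ ‖A‖ₑ := by
  have hy : (Measure.count : Measure R) {y} ≠ ⊤ := by simp
  set G := indicatorConstLp (μ := Measure.count) 2 (measurableSet_singleton y) hy (1 : ℂ) with hG
  have hGn : ‖G‖ₑ = 1 := by
    rw [← ofReal_norm, hG, norm_indicatorConstLp (by simp) (by simp)]
    simp [Measure.real]
  have hGy : G y = 1 := by
    have := Measure.ae_count_iff.1
      (indicatorConstLp_coeFn (p := 2) (hs := measurableSet_singleton y) (hμs := hy)
        (c := (1 : ℂ))) y
    rw [hG, this]; simp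
  have h2 : k x y ^ 2 ≤ (‖A‖ₑ * ‖G‖ₑ) ^ 2 := by
    refine le_trans ?_ (h.isENNKernelBound.bound G)
    rw [lintegral_count]
    refine le_trans ?_ (ENNReal.le_tsum x)
    gcongr
    rw [lintegral_count]
    refine le_trans ?_ (ENNReal.le_tsum y)
    simp [hGy]
  rw [hGn, mul_one] at h2
  exact (ENNReal.pow_le_pow_left_iff two_ne_zero).1 h2

theorem isHadamardExponent_count {m : ℕ} (hm : 0 < m) {α : ℝ} (hα : 1 / (m : ℝ) ≤ α) :
    IsHadamardExponent (Measure.count : Measure R) m α := by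
  have hm' : (0 : ℝ) < m := by exact_mod_cast hm
  have h0 : 0 < 1 / (m : ℝ) := by positivity
  have hα0 : 0 < α := h0.trans_le hα
  refine ⟨hα0, fun f hf => ?_, fun A k hk => ?_⟩
  · have ht : 1 ≤ (m : ℝ) * α := by
      rw [div_le_iff₀ hm'] at hα
      linarith
    have hpow : ∀ g : Fin m → ℝ≥0∞,
        (∏ j, g j ^ (1 / (m : ℝ))) ^ ((m : ℝ) * α) = ∏ j, g j ^ α := fun g => by
      rw [← ENNReal.prod_rpow_of_nonneg (by positivity)]
      refine Finset.prod_congr rfl fun j _ => ?_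
      rw [← ENNReal.rpow_mul]
      congr 1
      field_simp
    calc ∫⁻ x, ∏ j, f j x ^ α ∂Measure.count
        = ∫⁻ x, (∏ j, f j x ^ (1 / (m : ℝ))) ^ ((m : ℝ) * α) ∂Measure.count := by
          simp only [hpow]
      _ ≤ (∫⁻ x, ∏ j, f j x ^ (1 / (m : ℝ)) ∂Measure.count) ^ ((m : ℝ) * α) :=
          lintegral_count_rpow_le ht _
      _ ≤ (∏ j, (∫⁻ x, f j x ∂Measure.count) ^ (1 / (m : ℝ))) ^ ((m : ℝ) * α) :=
          ENNReal.rpow_le_rpow (lintegral_prod_rpow_one_div_le hm f fun j => (hf j).aemeasurable)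
            (by positivity)
      _ = _ := hpow _
  ·
    -- The entries are at most `‖A j‖`, so `k ^ α ≤ ‖A j‖ ^ (α - 1/m) * k ^ (1/m)`.
    have hsplit : ∀ c : ℝ≥0∞, c ^ α = c ^ (α - 1 / (m : ℝ)) * c ^ (1 / (m : ℝ)) := fun c => by
      rw [← ENNReal.rpow_add_of_nonneg _ _ (by linarith) h0.le, sub_add_cancel]
    set N : ℝ≥0∞ := ∏ j, ‖A j‖ₑ ^ (α - 1 / (m : ℝ)) with hN
    refine ⟨Finset.measurable_fun_prod _ fun j _ => (hk j).measurable.pow_const _, fun F => ?_⟩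
    calc ∫⁻ x, (∫⁻ y, (∏ j, k j x y ^ α) * ‖F y‖ₑ ∂Measure.count) ^ 2 ∂Measure.count
        ≤ ∫⁻ x, (∫⁻ y, N * ((∏ j, k j x y ^ (1 / (m : ℝ))) * ‖F y‖ₑ) ∂Measure.count) ^ 2
            ∂Measure.count := by
          refine lintegral_mono fun x => pow_le_pow_left' (lintegral_mono fun y => ?_) 2
          rw [← mul_assoc, hN, ← Finset.prod_mul_distrib]
          refine mul_le_mul' (Finset.prod_le_prod' fun j _ => ?_) le_rfl
          rw [hsplit]
          exact mul_le_mul' (ENNReal.rpow_le_rpow ((hk j).le_enorm_count x y) (by linarith)) le_rfl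
      _ = N ^ 2 * ∫⁻ x, (∫⁻ y, (∏ j, k j x y ^ (1 / (m : ℝ))) * ‖F y‖ₑ ∂Measure.count) ^ 2
            ∂Measure.count := by
          rw [← lintegral_const_mul _ (measurable_of_countable _)]
          refine lintegral_congr fun x => ?_
          rw [lintegral_const_mul _ (measurable_of_countable _), mul_pow]
      _ ≤ N ^ 2 * ((∏ j, ‖A j‖ₑ ^ (1 / (m : ℝ))) * ‖F‖ₑ) ^ 2 := by
          gcongr
          exact (isENNKernelBound_one_div hm A k hk).bound F
      _ = _ := by
          simp only [hsplit, Finset.prod_mul_distrib]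
          ring

end Counting

end KernelOperators

open KernelOperators in
theorem theorem3p8 (m : ℕ) (hm : Even m) (hm_pos : 0 < m) (τ ν : Equiv.Perm (Fin m)) :
    -- (i) positive kernel operators on L²(X, μ)
    (∀ (X : Type*) [MeasurableSpace X] (μ : Measure X) [SigmaFinite μ]
      (Ψ : Fin m → Set (L2Op μ)), (∀ j, IsBoundedPositiveKernelSet (Ψ j)) →
      ∀ S : Fin m → Set (L2Op μ), S = sigmaFamily hm τ Ψ →
      ∀ Ω : Fin m → Set (L2Op μ), Ω = omegaFamily ν S →
      (∀ j, IsBoundedPositiveKernelSet (S j)) ∧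
      (∀ i, IsBoundedPositiveKernelSet (Ω i)) ∧
      HadamardSetDefined (1 / (m : ℝ)) Ψ ∧
      HadamardSetDefined (1 / (m : ℝ)) S ∧
      HadamardSetDefined (1 / (m : ℝ)) Ω ∧
      ∀ r ∈ ({generalizedSpectralRadius, jointSpectralRadius} : Set (Set (L2Op μ) → ℝ≥0∞)),
        setNorm (hadamardSet (1 / (m : ℝ)) Ψ)
            ≤ r (hadamardSet (1 / (m : ℝ)) S) ^ (1 / 2 : ℝ) ∧
        r (hadamardSet (1 / (m : ℝ)) S) ^ (1 / 2 : ℝ)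
            ≤ r (hadamardSet (1 / (m : ℝ)) Ω) ^ (1 / (2 * (m : ℝ))) ∧
        r (hadamardSet (1 / (m : ℝ)) Ω) ^ (1 / (2 * (m : ℝ)))
            ≤ r (orderedProduct ν S) ^ (1 / (2 * (m : ℝ)))) ∧
    -- (ii) nonnegative matrices on ℓ²(R) = L²(R, counting measure)
    (∀ (R : Type*) [Countable R] [MeasurableSpace R] [DiscreteMeasurableSpace R]
      (Ψ : Fin m → Set (L2Op (Measure.count : Measure R))) (α : ℝ), 1 / (m : ℝ) ≤ α →
      (∀ j, IsBoundedPositiveKernelSet (Ψ j)) →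
      ∀ S : Fin m → Set (L2Op (Measure.count : Measure R)), S = sigmaFamily hm τ Ψ →
      ∀ Ω : Fin m → Set (L2Op (Measure.count : Measure R)), Ω = omegaFamily ν S →
      HadamardSetDefined α Ψ ∧
      HadamardSetDefined α S ∧
      HadamardSetDefined α Ω ∧
      ∀ r ∈ ({generalizedSpectralRadius, jointSpectralRadius} :
          Set (Set (L2Op (Measure.count : Measure R)) → ℝ≥0∞)),
        setNorm (hadamardSet α Ψ) ≤ r (hadamardSet α S) ^ (1 / 2 : ℝ) ∧
        r (hadamardSet α S) ^ (1 / 2 : ℝ)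
            ≤ r (hadamardSet α Ω) ^ (1 / (2 * (m : ℝ))) ∧
        r (hadamardSet α Ω) ^ (1 / (2 * (m : ℝ)))
            ≤ r (orderedProduct ν S) ^ (α / 2)) := by
  refine ⟨?_, ?_⟩
  · rintro X _ μ _ Ψ hΨ S rfl Ω rfl
    have hα : IsHadamardExponent μ m (1 / (m : ℝ)) := isHadamardExponent_one_div hm_pos
    have hS := isBoundedPositiveKernelSet_sigmaFamily hm τ hΨ
    have hΩ := isBoundedPositiveKernelSet_omegaFamily ν hS
    refine ⟨hS, hΩ, hα.hadamardSetDefined hΨ, hα.hadamardSetDefined hS,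
      hα.hadamardSetDefined hΩ, fun r hr => ?_⟩
    have he : 1 / (2 * (m : ℝ)) = 1 / (m : ℝ) / 2 := by rw [div_div, mul_comm]
    obtain ⟨h₁, h₂, h₃⟩ := hadamard_spectral_inequalities hm_pos hα hm τ ν hΨ hr
    exact ⟨h₁, h₂, h₃.trans_eq (by rw [he])⟩
  · rintro R _ _ _ Ψ α hmα hΨ S rfl Ω rfl
    have hα : IsHadamardExponent (Measure.count : Measure R) m α :=
      isHadamardExponent_count hm_pos hmα
    have hS := isBoundedPositiveKernelSet_sigmaFamily hm τ hΨ
    have hΩ := isBoundedPositiveKernelSet_omegaFamily ν hS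
    exact ⟨hα.hadamardSetDefined hΨ, hα.hadamardSetDefined hS, hα.hadamardSetDefined hΩ,
      fun r hr => hadamard_spectral_inequalities hm_pos hα hm τ ν hΨ hr⟩
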